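/- **Setting.** Let $m_1,m_2\in\mathbb N_0$, $m=m_1+m_2>0$, $j=\mathrm{diag}\{I_{m_1},-I_{m_2}\}$, let $c_1,\dots,c_r\in\mathbb R$ be pairwise distinct, let $\mathcal I\subseteq\mathbb R$ be an interval with $0\in\mathcal I$, and let $\beta_k:\mathcal I\to\mathbb C^{p\times m}$ $(1\le k\le r,\ p\le m)$ be such that the Hamiltonians $H_k=\beta_k^*\beta_k$ are locally summable on $\mathcal I$. Consider the generalised Hamiltonian system $$y'(x,z)=G(x,z)y(x,z),\qquad G(x,z)=\mathrm i\sum_{k=1}^r (z-c_k)^{-1}j\beta_k(x)^*\beta_k(x),\qquad x\in\mathcal I .$$ Differential equations are understood almost everywhere, for locally absolutely continuous functions. Let $n\in\mathbb N$, $A,S(0)\in\mathbb C^{n\times n}$, $\Pi(0)\in\mathbb C^{n\times m}$ satisfy $$AS(0)-S(0)A^*=\mathrm i\,\Pi(0)j\Pi(0)^*,\qquad S(0)=S(0)^*,\qquad c_k\notin\sigma(A)\quad(1\le k\le r).$$ **Theorem.** The equations $$\Pi'=-\mathrm i\sum_{k=1}^r(A-c_kI_n)^{-1}\Pi jH_k,\qquad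 S'=-\sum_{k=1}^r(A-c_kI_n)^{-1}\Pi jH_kj\Pi^*(A^*-c_kI_n)^{-1}$$ with the given values $\Pi(0),S(0)$ have a unique solution $(\Pi,S)$ on $\mathcal I$. Put $$w_A(x,z)=I_m-\mathrm i\,j\Pi(x)^*S(x)^{-1}(A-zI_n)^{-1}\Pi(x),$$ and let the GBDT-transformed system be $\widetilde y'=\widetilde G\widetilde y$ with $\widetilde G(x,z)=-\sum_{k=1}^r(z-c_k)^{-1}\widetilde q_k(x)$, where, for $q_k=-\mathrm i jH_k$, $$\widetilde q_k=q_k+q_kY_k-X_kq_k-X_kq_kY_k,$$ $$X_k=\mathrm i j\Pi^*S^{-1}(A-c_kI_n)^{-1}\Pi,\qquad Y_k=\mathrm i j\Pi^*(A^*-c_kI_n)^{-1}S^{-1}\Pi .$$ Let $\mathcal J\subseteq\mathcal I$ be any subinterval on which $S(x)$ is invertible (for instance $\mathcal J=\mathcal I$ if $S$ is invertible on $\mathcal I$). Then: 1. On $\mathcal J$ the transformed system has the same form as the initial one: $\widetilde q_k=-\mathrm i j\widetilde H_k$, that is, $$\widetilde G(x,z)=\mathrm i\sum_{k=1}^r(z-c_k)^{-1}j\widetilde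 H_k(x),\qquad \widetilde H_k=\widetilde\beta_k^*\widetilde\beta_k,\qquad \widetilde\beta_k(x)=\beta_k(x)\,j\,w_A(x,c_k)^*\,j,$$ and the $\widetilde H_k$ are locally summable on $\mathcal J$. 2. For every $z\in\mathbb C\setminus(\sigma(A)\cup\{c_1,\dots,c_r\})$ the function $w_A(\cdot,z)$ satisfies $$w_A'(x,z)=\widetilde G(x,z)w_A(x,z)-w_A(x,z)G(x,z)$$ on $\mathcal J$, and $w_Aw$ is a matrix solution of the transformed system on $\mathcal J$ whenever $w$ is an $m\times m$ matrix solution of the initial one. 3. If, in addition, $z\notin\sigma(A^*)$, then $w_A(x,z)$ is invertible for all $x\in\mathcal J$, so that $w_A$ is a Darboux matrix, and for every fundamental (that is, invertible $m\times m$ matrix) solution $w(x,z)$ of the initial system on $\mathcal J$ the function $$\widetilde w(x,z)=w_A(x,z)w(x,z)$$ is a fundamental solution of the transformed system on $\mathcal J$. -/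

import Mathlib

open scoped Matrix

noncomputable section

namespace GBDT

/-- A matrix function on the real line is locally summable on `J` when all its entries are. -/
def LocSummableOn {ι κ : Type} (J : Set ℝ) (F : ℝ → Matrix ι κ ℂ) : Prop :=
  ∀ i l, MeasureTheory.LocallyIntegrableOn (fun x => F x i l) J

/-- `Y' = F` on the interval `J` in the sense of Carathéodory: every entry of `Y` is absolutely
continuous on each compact subinterval of `J`, and the derivative of `Y` equals `F` almost
everywhere on `J`. -/
structure HasAEDerivOn {ι κ : Type} (J : Set ℝ) (Y F : ℝ → Matrix ι κ ℂ) : Prop where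
  ac : ∀ i l, ∀ a ∈ J, ∀ b ∈ J, AbsolutelyContinuousOnInterval (fun x => Y x i l) a b
  deriv : ∀ᵐ x : ℝ, x ∈ J → ∀ i l, HasDerivAt (fun t => Y t i l) (F x i l) x

/-- The matrix function `W` satisfies `W' = G̃ W - W G` on `J`. -/
def SolvesDarbouxEq {ι : Type} [Fintype ι] (J : Set ℝ) (G G' W : ℝ → Matrix ι ι ℂ) : Prop :=
  HasAEDerivOn J W (fun x => G' x * W x - W x * G x)

/-- `W` is a Darboux matrix on `J` for the pair of systems `y' = G y` and `y' = G̃ y`: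
a nondegenerate solution of `W' = G̃ W - W G`. -/
structure IsDarbouxMatrix {ι : Type} [Fintype ι] [DecidableEq ι] (J : Set ℝ)
    (G G' W : ℝ → Matrix ι ι ℂ) : Prop where
  eqn : SolvesDarbouxEq J G G' W
  nondegenerate : ∀ x ∈ J, IsUnit (W x)

/-- `w` is a (square) matrix solution of `y' = G y` on `J`. -/
def IsMatrixSolution {ι : Type} [Fintype ι] (J : Set ℝ) (G w : ℝ → Matrix ι ι ℂ) : Prop :=
  HasAEDerivOn J w (fun x => G x * w x)

/-- `w` is a fundamental solution of `y' = G y` on `J`: an invertible matrix solution. -/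
structure IsFundamentalSolution {ι : Type} [Fintype ι] [DecidableEq ι] (J : Set ℝ)
    (G w : ℝ → Matrix ι ι ℂ) : Prop where
  solution : IsMatrixSolution J G w
  invertible : ∀ x ∈ J, IsUnit (w x)

/-- The signature matrix `j = diag(I_{m₁}, -I_{m₂})`. -/
def sig (m₁ m₂ : ℕ) : Matrix (Fin m₁ ⊕ Fin m₂) (Fin m₁ ⊕ Fin m₂) ℂ :=
  Matrix.fromBlocks 1 0 0 (-1)

variable {r m₁ m₂ p n : ℕ}

/-- The coefficient `i ∑ₖ (z - cₖ)⁻¹ j βₖ(x)^* βₖ(x)` of the generalised Hamiltonian system. -/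
def hamCoeff (c : Fin r → ℝ) (β : Fin r → ℝ → Matrix (Fin p) (Fin m₁ ⊕ Fin m₂) ℂ)
    (z : ℂ) (x : ℝ) : Matrix (Fin m₁ ⊕ Fin m₂) (Fin m₁ ⊕ Fin m₂) ℂ :=
  Complex.I • ∑ k, (z - (c k : ℂ))⁻¹ • (sig m₁ m₂ * ((β k x)ᴴ * β k x))

/-- The resolvent-type factor `(A - z I_n)⁻¹`. -/
def res (A : Matrix (Fin n) (Fin n) ℂ) (z : ℂ) : Matrix (Fin n) (Fin n) ℂ :=
  (A - z • (1 : Matrix (Fin n) (Fin n) ℂ))⁻¹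

/-- The matrix functions `Π` and `S` on the interval `I` determined by the triple
`{A, S(0), Π(0)} = {A, S₀, Π₀}`:
`Π' = -i ∑ₖ (A - cₖ)⁻¹ Π j Hₖ` and `S' = -∑ₖ (A - cₖ)⁻¹ Π j Hₖ j Π^* (A^* - cₖ)⁻¹`,
where `Hₖ = βₖ^* βₖ`. -/
structure IsNodeFlow (I : Set ℝ) (c : Fin r → ℝ)
    (β : Fin r → ℝ → Matrix (Fin p) (Fin m₁ ⊕ Fin m₂) ℂ)
    (A S₀ : Matrix (Fin n) (Fin n) ℂ) (P₀ : Matrix (Fin n) (Fin m₁ ⊕ Fin m₂) ℂ)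
    (P : ℝ → Matrix (Fin n) (Fin m₁ ⊕ Fin m₂) ℂ) (S : ℝ → Matrix (Fin n) (Fin n) ℂ) : Prop where
  P_zero : P 0 = P₀
  S_zero : S 0 = S₀
  P_eqn : HasAEDerivOn I P (fun x =>
    (-Complex.I) • ∑ k, res A (c k) * P x * sig m₁ m₂ * ((β k x)ᴴ * β k x))
  S_eqn : HasAEDerivOn I S (fun x =>
    -∑ k, res A (c k) * P x * sig m₁ m₂ * ((β k x)ᴴ * β k x) * sig m₁ m₂ * (P x)ᴴ
      * res Aᴴ (c k))

/-- The transfer matrix function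
`w_A(x, z) = I_m - i j Π(x)^* S(x)⁻¹ (A - z I_n)⁻¹ Π(x)`. -/
def transfer (A : Matrix (Fin n) (Fin n) ℂ) (P : ℝ → Matrix (Fin n) (Fin m₁ ⊕ Fin m₂) ℂ)
    (S : ℝ → Matrix (Fin n) (Fin n) ℂ) (z : ℂ) (x : ℝ) :
    Matrix (Fin m₁ ⊕ Fin m₂) (Fin m₁ ⊕ Fin m₂) ℂ :=
  1 - Complex.I • (sig m₁ m₂ * (P x)ᴴ * (S x)⁻¹ * res A z * P x)

/-- The transformed coefficient `q̃ = q + q Y - X q - X q Y` of a simple pole `(z - c)⁻¹` under the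
generalised Bäcklund-Darboux transformation determined by an S-node
`A₁ S - S A₂ = Π₁ Π₂^*` (the argument `P₂s` is `Π₂^*`), where
`X = Π₂^* S⁻¹ (A₁ - c)⁻¹ Π₁` and `Y = Π₂^* (A₂ - c)⁻¹ S⁻¹ Π₁`. -/
def nodeCoeff {ι : Type} [Fintype ι] (A₁ A₂ S : Matrix (Fin n) (Fin n) ℂ)
    (P₁ : Matrix (Fin n) ι ℂ) (P₂s : Matrix ι (Fin n) ℂ) (c : ℂ) (q : Matrix ι ι ℂ) :
    Matrix ι ι ℂ :=
  let X := P₂s * S⁻¹ * res A₁ c * P₁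
  let Y := P₂s * res A₂ c * S⁻¹ * P₁
  q + q * Y - X * q - X * q * Y

/-- The coefficient `q̃ₖ(x)` of the GBDT-transformed system. The initial generalised Hamiltonian
system is `y' = -(∑ₖ (z - cₖ)⁻¹ qₖ) y` with `qₖ = -i j Hₖ`, and the S-node is the symmetric one:
`A₁ = A`, `A₂ = A^*`, `Π₁ = Π`, `Π₂^* = i j Π^*`. -/
def gbdtCoeff (c : Fin r → ℝ) (β : Fin r → ℝ → Matrix (Fin p) (Fin m₁ ⊕ Fin m₂) ℂ)
    (A : Matrix (Fin n) (Fin n) ℂ) (P : ℝ → Matrix (Fin n) (Fin m₁ ⊕ Fin m₂) ℂ)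
    (S : ℝ → Matrix (Fin n) (Fin n) ℂ) (k : Fin r) (x : ℝ) :
    Matrix (Fin m₁ ⊕ Fin m₂) (Fin m₁ ⊕ Fin m₂) ℂ :=
  nodeCoeff A Aᴴ (S x) (P x) (Complex.I • (sig m₁ m₂ * (P x)ᴴ)) (c k)
    ((-Complex.I) • (sig m₁ m₂ * ((β k x)ᴴ * β k x)))

/-- The coefficient `G̃(x, z) = -∑ₖ (z - cₖ)⁻¹ q̃ₖ(x)` of the GBDT-transformed system. -/
def gbdtSystem (c : Fin r → ℝ) (β : Fin r → ℝ → Matrix (Fin p) (Fin m₁ ⊕ Fin m₂) ℂ)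
    (A : Matrix (Fin n) (Fin n) ℂ) (P : ℝ → Matrix (Fin n) (Fin m₁ ⊕ Fin m₂) ℂ)
    (S : ℝ → Matrix (Fin n) (Fin n) ℂ) (z : ℂ) (x : ℝ) :
    Matrix (Fin m₁ ⊕ Fin m₂) (Fin m₁ ⊕ Fin m₂) ℂ :=
  -∑ k, (z - (c k : ℂ))⁻¹ • gbdtCoeff c β A P S k x

/-- The transformed factors `β̃ₖ(x) = βₖ(x) j w_A(x, cₖ)^* j`. -/
def betaT (c : Fin r → ℝ) (β : Fin r → ℝ → Matrix (Fin p) (Fin m₁ ⊕ Fin m₂) ℂ)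
    (A : Matrix (Fin n) (Fin n) ℂ) (P : ℝ → Matrix (Fin n) (Fin m₁ ⊕ Fin m₂) ℂ)
    (S : ℝ → Matrix (Fin n) (Fin n) ℂ) (k : Fin r) (x : ℝ) :
    Matrix (Fin p) (Fin m₁ ⊕ Fin m₂) ℂ :=
  β k x * sig m₁ m₂ * (transfer A P S (c k) x)ᴴ * sig m₁ m₂

end GBDT

end

noncomputable section

namespace GBDT

open MeasureTheory Set Filter Topology Interval

/-! The algebra rests on two facts. The node identity `A S - S Aᴴ = i Π j Πᴴ` persists along the
flow, because both sides have the same derivative (`IsNodeFlow.node_identity`), and `S` stays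
Hermitian because the `c k` are real. With `cotransfer` written for `1 + i j Πᴴ (Aᴴ - z)⁻¹ S⁻¹ Π`,
the node identity collapses the quadratic term of `cotransfer w * transfer z` and leaves `1` plus a
multiple of `z - w` (`cotransfer_mul_transfer`). At `w = z` this inverts the transfer function.

Since `transfer = 1 - X` and `cotransfer = 1 + Y`, each transformed coefficient factors as `transfer
* q * cotransfer` at `c k`. As `c k` is real and `S` Hermitian, the cotransfer there is `j
(transfer)ᴴ j`, so the Hamiltonian form survives. In the Darboux equation each pole `(z - c k)⁻¹` is
cancelled by a factor `z - c k`, from the product formula and the Hilbert identity (`darboux_term`).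

The analysis is the Carathéodory theory of linear systems with locally summable coefficients:
existence by the Peano-Baker series, uniqueness by pairing with the adjoint equation. The equation
for `Π` is linear and does not involve `S`; `S` is then a primitive. -/

/-! ### Absolute continuity and primitives of summable functions. -/

/-- Over any finite family of disjoint subintervals the total oscillation of `f` is bounded by a
fixed linear combination of those of the `g k`, each tending to zero with the total length.
Conjugates, matrix products and matrix inverses are all treated this way. -/
theorem absolutelyContinuousOnInterval_of_dist_le_sum {κ X Y : Type*} [PseudoMetricSpace X]
    [PseudoMetricSpace Y] (s : Finset κ) {f : ℝ → X} {g : κ → ℝ → Y} (K : κ → ℝ) {a b : ℝ}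
    (hg : ∀ k ∈ s, AbsolutelyContinuousOnInterval (g k) a b)
    (h : ∀ u ∈ uIcc a b, ∀ v ∈ uIcc a b,
      dist (f u) (f v) ≤ ∑ k ∈ s, K k * dist (g k u) (g k v)) :
    AbsolutelyContinuousOnInterval f a b := by
  unfold AbsolutelyContinuousOnInterval at hg ⊢
  have hlim := tendsto_finsetSum s fun k hk => (hg k hk).const_mul (K k)
  simp only [mul_zero, Finset.sum_const_zero] at hlim
  refine squeeze_zero' (Eventually.of_forall fun E => Finset.sum_nonneg fun i _ => dist_nonneg)
    ?_ hlim
  refine mem_inf_of_right (mem_principal.2 fun E hE => ?_)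
  simp only [Finset.mul_sum]
  rw [mem_ofPred_eq, Finset.sum_comm]
  exact Finset.sum_le_sum fun i hi => h _ (hE.1 i hi).1 _ (hE.1 i hi).2

theorem absolutelyContinuousOnInterval_const {X : Type*} [PseudoMetricSpace X] (x : X) (a b : ℝ) :
    AbsolutelyContinuousOnInterval (fun _ => x) a b := by
  simpa [AbsolutelyContinuousOnInterval] using tendsto_const_nhds

theorem _root_.AbsolutelyContinuousOnInterval.congr {X : Type*} [PseudoMetricSpace X]
    {f g : ℝ → X} {a b : ℝ} (hf : AbsolutelyContinuousOnInterval f a b)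
    (h : ∀ x ∈ uIcc a b, g x = f x) : AbsolutelyContinuousOnInterval g a b :=
  absolutelyContinuousOnInterval_of_dist_le_sum {()} (g := fun _ => f) (fun _ => 1)
    (fun _ _ => hf) fun u hu v hv => by simp [h u hu, h v hv]

theorem absolutelyContinuousOnInterval_integral {E : Type*} [NormedAddCommGroup E]
    [NormedSpace ℝ E] {f : ℝ → E} {a b : ℝ} (hf : IntervalIntegrable f volume a b) :
    AbsolutelyContinuousOnInterval (fun x => ∫ t in a..x, f t) a b := by
  refine absolutelyContinuousOnInterval_of_dist_le_sum {()} (fun _ => 1)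
    (fun _ _ => hf.norm.absolutelyContinuousOnInterval_intervalIntegral left_mem_uIcc)
    fun u hu v hv => ?_
  have hu' : IntervalIntegrable f volume a u := hf.mono_set (uIcc_subset_uIcc_left hu)
  have hv' : IntervalIntegrable f volume a v := hf.mono_set (uIcc_subset_uIcc_left hv)
  rw [dist_eq_norm, intervalIntegral.integral_interval_sub_left hu' hv']
  simp only [Finset.sum_singleton, one_mul]
  rw [dist_eq_norm, intervalIntegral.integral_interval_sub_left hu'.norm hv'.norm]
  exact intervalIntegral.norm_integral_le_abs_integral_norm

theorem intervalIntegrable_of_locallyIntegrableOn {E : Type*} [NormedAddCommGroup E]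
    {f : ℝ → E} {I : Set ℝ} (hI : I.OrdConnected) (hf : LocallyIntegrableOn f I)
    {a b : ℝ} (ha : a ∈ I) (hb : b ∈ I) : IntervalIntegrable f volume a b :=
  (hf.integrableOn_compact_subset (hI.uIcc_subset ha hb) isCompact_uIcc).intervalIntegrable

theorem ae_hasDerivAt_integral_of_intervalIntegrable {E : Type*} [NormedAddCommGroup E]
    [NormedSpace ℝ E] [CompleteSpace E] {f : ℝ → E} {I : Set ℝ} {a : ℝ} (ha : a ∈ I)
    (hf : ∀ b ∈ I, ∀ c ∈ I, IntervalIntegrable f volume b c) :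
    ∀ᵐ x, x ∈ I → HasDerivAt (fun x => ∫ t in a..x, f t) (f x) x := by
  -- The base point `a` may lie outside `[b, c]`. On `(b, c)` the primitive from `a` differs from
  -- the one from `b` by a constant, so Lebesgue differentiation on `[b, c]` suffices.
  refine ae_of_mem_of_ae_of_mem_inter_Ioo fun b c hb hc hbc => ?_
  filter_upwards [(hf b hb c hc).ae_hasDerivAt_integral] with x hx hxI
  have hd := (hx (Ioo_subset_Icc_self.trans Icc_subset_uIcc hxI.2) b left_mem_uIcc).const_add
    (∫ t in a..b, f t)
  refine hd.congr_of_eventuallyEq ?_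
  filter_upwards [Ioo_mem_nhds hxI.2.1 hxI.2.2] with y hy
  refine (intervalIntegral.integral_add_adjacent_intervals (hf a ha b hb) ?_).symm
  exact (hf b hb c hc).mono_set
    (uIcc_subset_uIcc_left (Ioo_subset_Icc_self.trans Icc_subset_uIcc hy))

/-- The primitive `M` is absolutely continuous, hence so is `M ^ (n + 1)`, whose derivative is a.e.
`(n + 1) f M ^ n`; no continuity of `f` is needed. -/
theorem integral_mul_pow_integral {f : ℝ → ℝ} {a b : ℝ} (hf : IntervalIntegrable f volume a b)
    (n : ℕ) : ∫ t in a..b, f t * (∫ s in a..t, f s) ^ n =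
      (∫ s in a..b, f s) ^ (n + 1) / (n + 1) := by
  set M : ℝ → ℝ := fun x => ∫ s in a..x, f s with hM
  have hac : AbsolutelyContinuousOnInterval M a b :=
    hf.absolutelyContinuousOnInterval_intervalIntegral left_mem_uIcc
  have hpow : ∀ k : ℕ, AbsolutelyContinuousOnInterval (fun x => M x ^ k) a b := by
    intro k
    induction k with
    | zero => simpa using absolutelyContinuousOnInterval_const (1 : ℝ) a b
    | succ k ih => simpa only [pow_succ] using! ih.mul hac
  have h := (hpow (n + 1)).integral_deriv_eq_sub
  have hMa : M a = 0 := by simp [hM]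
  rw [hMa, zero_pow n.succ_ne_zero, sub_zero] at h
  have hcong : ∫ x in a..b, deriv (fun x => M x ^ (n + 1)) x =
      ∫ x in a..b, ((n : ℝ) + 1) * (f x * M x ^ n) := by
    refine intervalIntegral.integral_congr_ae ?_
    filter_upwards [hf.ae_hasDerivAt_integral] with x hx hxm
    have := (hx (uIoc_subset_uIcc hxm) a left_mem_uIcc).fun_pow (n + 1)
    rw [this.deriv]
    push_cast
    simp only [hM]
    ring
  rw [hcong, intervalIntegral.integral_const_mul] at h
  rw [eq_div_iff (by positivity), mul_comm]
  exact h

theorem intervalIntegrable_mul_of_continuousOn {𝔸 : Type*} [NormedRing 𝔸] {f g : ℝ → 𝔸}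
    {a b : ℝ}
    (hf : IntervalIntegrable f volume a b) (hg : ContinuousOn g (uIcc a b)) :
    IntervalIntegrable (fun t => f t * g t) volume a b := by
  rw [intervalIntegrable_iff'] at hf ⊢
  exact hf.mul_continuousOn hg isCompact_uIcc

/-! ### The Peano-Baker series in a Banach algebra. -/

section PeanoBaker

variable {𝔸 : Type*} [NormedRing 𝔸] [NormedAlgebra ℝ 𝔸]

/-- The terms of the Peano-Baker series of `U' = L U`, `U a = 1`. -/
def peanoBaker (L : ℝ → 𝔸) (a : ℝ) : ℕ → ℝ → 𝔸
  | 0 => fun _ => 1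
  | k + 1 => fun x => ∫ t in a..x, L t * peanoBaker L a k t

variable {L : ℝ → 𝔸} {a b : ℝ}

theorem continuousOn_peanoBaker (hL : IntervalIntegrable L volume a b) (k : ℕ) :
    ContinuousOn (peanoBaker L a k) (uIcc a b) := by
  induction k with
  | zero => exact continuousOn_const
  | succ k ih =>
    exact intervalIntegral.continuousOn_primitive_interval'
      (intervalIntegrable_mul_of_continuousOn hL ih) left_mem_uIcc

theorem norm_peanoBaker_le (hL : IntervalIntegrable L volume a b) (k : ℕ) :
    ‖peanoBaker L a k b‖ ≤ ‖(1 : 𝔸)‖ * (|∫ t in a..b, ‖L t‖| ^ k / k.factorial) := by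
  induction k generalizing b with
  | zero => simp [peanoBaker]
  | succ k ih =>
    set M : ℝ → ℝ := fun x => ∫ s in a..x, ‖L s‖ with hM
    have hMc : ContinuousOn M (uIcc a b) :=
      intervalIntegral.continuousOn_primitive_interval' hL.norm left_mem_uIcc
    have hint : IntervalIntegrable (fun t => ‖(1 : 𝔸)‖ / k.factorial * (‖L t‖ * |M t| ^ k))
        volume a b :=
      (intervalIntegrable_mul_of_continuousOn hL.norm (hMc.abs.pow k)).const_mul _
    have hle : ‖peanoBaker L a (k + 1) b‖ ≤
        |∫ t in a..b, ‖(1 : 𝔸)‖ / k.factorial * (‖L t‖ * |M t| ^ k)| := by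
      refine intervalIntegral.norm_integral_le_abs_of_norm_le ?_ hint
      refine (ae_restrict_iff' measurableSet_uIoc).2 (Eventually.of_forall fun t ht => ?_)
      have ht' := ih (hL.mono_set (uIcc_subset_uIcc_left (uIoc_subset_uIcc ht)))
      calc ‖L t * peanoBaker L a k t‖ ≤ ‖L t‖ * ‖peanoBaker L a k t‖ := norm_mul_le _ _
        _ ≤ ‖L t‖ * (‖(1 : 𝔸)‖ * (|M t| ^ k / k.factorial)) := by gcongr
        _ = _ := by ring
    -- `M` has constant sign between `a` and `b`, namely that of `b - a`, so replacing `|M| ^ k` by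
    -- `M ^ k` costs at most a global sign.
    have habs : |∫ t in a..b, ‖L t‖ * |M t| ^ k| = |∫ t in a..b, ‖L t‖ * M t ^ k| := by
      rcases le_total a b with hab | hab
      · congr 1
        refine intervalIntegral.integral_congr fun t ht => ?_
        rw [uIcc_of_le hab] at ht
        have : 0 ≤ M t := intervalIntegral.integral_nonneg ht.1 fun _ _ => norm_nonneg _
        simp only [abs_of_nonneg this]
      · have : ∫ t in a..b, ‖L t‖ * |M t| ^ k = ∫ t in a..b, (-1) ^ k * (‖L t‖ * M t ^ k) := by
          refine intervalIntegral.integral_congr fun t ht => ?_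
          rw [uIcc_of_ge hab] at ht
          have : M t ≤ 0 := by
            rw [hM]
            simp only
            rw [intervalIntegral.integral_symm, neg_nonpos]
            exact intervalIntegral.integral_nonneg ht.2 fun _ _ => norm_nonneg _
          simp only [abs_of_nonpos this]
          rw [neg_pow]
          ring
        rw [this, intervalIntegral.integral_const_mul, abs_mul]
        simp
    rw [intervalIntegral.integral_const_mul, abs_mul, habs, integral_mul_pow_integral hL.norm,
      abs_of_nonneg (show (0 : ℝ) ≤ ‖(1 : 𝔸)‖ / k.factorial by positivity), abs_div, abs_pow,
      abs_of_nonneg (show (0 : ℝ) ≤ (k : ℝ) + 1 by positivity)] at hle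
    refine hle.trans_eq ?_
    rw [Nat.factorial_succ]
    push_cast
    field_simp

theorem norm_peanoBaker_le_of_mem (hL : IntervalIntegrable L volume a b) (k : ℕ) {t : ℝ}
    (ht : t ∈ uIcc a b) :
    ‖peanoBaker L a k t‖ ≤ ‖(1 : 𝔸)‖ * (|∫ t in a..b, ‖L t‖| ^ k / k.factorial) := by
  refine (norm_peanoBaker_le (hL.mono_set (uIcc_subset_uIcc_left ht)) k).trans ?_
  have h : |∫ s in a..t, ‖L s‖| ≤ |∫ s in a..b, ‖L s‖| :=
    intervalIntegral.abs_integral_mono_interval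
      (uIoc_subset_uIoc_of_uIcc_subset_uIcc (uIcc_subset_uIcc_left ht))
      (Eventually.of_forall fun _ => norm_nonneg _) hL.norm
  gcongr ?_ * (?_ ^ k / _)

theorem summable_const_mul_pow_div_factorial (C x : ℝ) :
    Summable fun k : ℕ => C * (x ^ k / k.factorial) :=
  (Real.summable_pow_div_factorial x).mul_left C

variable [CompleteSpace 𝔸]

theorem continuousOn_tsum_peanoBaker (hL : IntervalIntegrable L volume a b) :
    ContinuousOn (fun x => ∑' k, peanoBaker L a k x) (uIcc a b) :=
  continuousOn_tsum (continuousOn_peanoBaker hL) (summable_const_mul_pow_div_factorial _ _)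
    fun k _ ht => norm_peanoBaker_le_of_mem hL k ht

theorem summable_peanoBaker (hL : IntervalIntegrable L volume a b) :
    Summable fun k => peanoBaker L a k b :=
  Summable.of_norm_bounded (summable_const_mul_pow_div_factorial _ _) (norm_peanoBaker_le hL)

/-- The series is integrated term by term, dominated by `‖L‖` times an exponential series. -/
theorem tsum_peanoBaker_eq (hL : IntervalIntegrable L volume a b) :
    ∑' k, peanoBaker L a k b = 1 + ∫ t in a..b, L t * ∑' k, peanoBaker L a k t := by
  rw [(summable_peanoBaker hL).tsum_eq_zero_add]
  congr 1
  refine HasSum.tsum_eq ?_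
  set K : ℝ := |∫ t in a..b, ‖L t‖|
  have hs := summable_const_mul_pow_div_factorial ‖(1 : 𝔸)‖ K
  refine intervalIntegral.hasSum_integral_of_dominated_convergence
    (fun k t => ‖L t‖ * (‖(1 : 𝔸)‖ * (K ^ k / k.factorial))) ?_ ?_ ?_ ?_ ?_
  · intro k
    exact (intervalIntegrable_mul_of_continuousOn hL
      (continuousOn_peanoBaker hL k)).aestronglyMeasurable_restrict_uIoc
  · intro k
    refine Eventually.of_forall fun t ht => (norm_mul_le _ _).trans ?_
    gcongr
    exact norm_peanoBaker_le_of_mem hL k (uIoc_subset_uIcc ht)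
  · exact Eventually.of_forall fun t _ => hs.mul_left _
  · simp only [tsum_mul_left]
    exact hL.norm.mul_const _
  · refine Eventually.of_forall fun t ht => ?_
    exact (summable_peanoBaker
      (hL.mono_set (uIcc_subset_uIcc_left (uIoc_subset_uIcc ht)))).hasSum.mul_left _

theorem exists_integral_equation_solution {I : Set ℝ} (hI : I.OrdConnected) (ha : a ∈ I)
    (hL : LocallyIntegrableOn L I) :
    ∃ U : ℝ → 𝔸, (∀ b ∈ I, ∀ c ∈ I, IntervalIntegrable (fun t => L t * U t) volume b c) ∧
      ∀ x ∈ I, U x = 1 + ∫ t in a..x, L t * U t := by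
  have hLi : ∀ b ∈ I, IntervalIntegrable L volume a b := fun b hb =>
    intervalIntegrable_of_locallyIntegrableOn hI hL ha hb
  refine ⟨fun x => ∑' k, peanoBaker L a k x, fun b hb c hc => ?_, fun x hx =>
    tsum_peanoBaker_eq (hLi x hx)⟩
  have h : ∀ b ∈ I, IntervalIntegrable (fun t => L t * ∑' k, peanoBaker L a k t) volume a b :=
    fun b hb => intervalIntegrable_mul_of_continuousOn (hLi b hb)
      (continuousOn_tsum_peanoBaker (hLi b hb))
  exact (h b hb).symm.trans (h c hc)

end PeanoBaker

/-! ### From compact subintervals to local statements. -/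

/-- When `J` has no point on one side of `x`, the point `x` itself serves as that endpoint; this
covers endpoints belonging to `J`. -/
theorem exists_uIcc_mem_nhdsWithin {J : Set ℝ} {x : ℝ} (hx : x ∈ J) :
    ∃ a ∈ J, ∃ b ∈ J, x ∈ uIcc a b ∧ uIcc a b ∈ 𝓝[J] x := by
  have hl : ∃ a ∈ J, a ≤ x ∧ Ici a ∈ 𝓝[J] x := by
    by_cases h : ∃ a ∈ J, a < x
    · obtain ⟨a, ha, hax⟩ := h
      exact ⟨a, ha, hax.le, mem_nhdsWithin_of_mem_nhds (Ici_mem_nhds hax)⟩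
    · push Not at h
      exact ⟨x, hx, le_rfl, mem_of_superset self_mem_nhdsWithin h⟩
  have hr : ∃ b ∈ J, x ≤ b ∧ Iic b ∈ 𝓝[J] x := by
    by_cases h : ∃ b ∈ J, x < b
    · obtain ⟨b, hb, hxb⟩ := h
      exact ⟨b, hb, hxb.le, mem_nhdsWithin_of_mem_nhds (Iic_mem_nhds hxb)⟩
    · push Not at h
      exact ⟨x, hx, le_rfl, mem_of_superset self_mem_nhdsWithin h⟩
  obtain ⟨a, ha, hax, hal⟩ := hl
  obtain ⟨b, hb, hxb, hbr⟩ := hr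
  refine ⟨a, ha, b, hb, ?_, ?_⟩
  · rw [uIcc_of_le (hax.trans hxb)]
    exact ⟨hax, hxb⟩
  · rw [uIcc_of_le (hax.trans hxb), ← Ici_inter_Iic]
    exact inter_mem hal hbr

theorem continuousOn_of_uIcc {E : Type*} [TopologicalSpace E] {J : Set ℝ} {f : ℝ → E}
    (hf : ∀ a ∈ J, ∀ b ∈ J, ContinuousOn f (uIcc a b)) : ContinuousOn f J := by
  intro x hx
  obtain ⟨a, ha, b, hb, hxab, hn⟩ := exists_uIcc_mem_nhdsWithin hx
  exact (hf a ha b hb x hxab).mono_of_mem_nhdsWithin hn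

theorem locallyIntegrableOn_iff_intervalIntegrable {E : Type*} [NormedAddCommGroup E]
    {J : Set ℝ} (hJ : J.OrdConnected) {f : ℝ → E} :
    LocallyIntegrableOn f J ↔ ∀ a ∈ J, ∀ b ∈ J, IntervalIntegrable f volume a b := by
  refine ⟨fun h a ha b hb => intervalIntegrable_of_locallyIntegrableOn hJ h ha hb,
    fun h x hx => ?_⟩
  obtain ⟨a, ha, b, hb, hxab, hn⟩ := exists_uIcc_mem_nhdsWithin hx
  exact ⟨_, hn, intervalIntegrable_iff' (by simp) |>.1 (h a ha b hb)⟩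

/-! ### Locally summable matrix functions. -/

section LocSummable

variable {ι κ μ : Type} {J : Set ℝ}

theorem LocSummableOn.mono {I : Set ℝ} {F : ℝ → Matrix ι κ ℂ} (hF : LocSummableOn I F)
    (h : J ⊆ I) : LocSummableOn J F :=
  fun i l => (hF i l).mono_set h

theorem LocSummableOn.continuousOn_mul [Fintype κ] (hJ : J.OrdConnected) {G : ℝ → Matrix ι κ ℂ}
    {F : ℝ → Matrix κ μ ℂ} (hG : ∀ i l, ContinuousOn (fun x => G x i l) J)
    (hF : LocSummableOn J F) : LocSummableOn J (fun x => G x * F x) := by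
  intro i l
  rw [locallyIntegrableOn_iff_intervalIntegrable hJ]
  intro a ha b hb
  simp only [Matrix.mul_apply]
  have := fun k => intervalIntegrable_mul_of_continuousOn
    (intervalIntegrable_of_locallyIntegrableOn hJ (hF k l) ha hb)
    ((hG i k).mono (hJ.uIcc_subset ha hb))
  simpa only [mul_comm, Finset.sum_fn] using! IntervalIntegrable.sum Finset.univ fun k _ => this k

theorem LocSummableOn.mul_continuousOn [Fintype κ] (hJ : J.OrdConnected) {F : ℝ → Matrix ι κ ℂ}
    {G : ℝ → Matrix κ μ ℂ} (hF : LocSummableOn J F)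
    (hG : ∀ i l, ContinuousOn (fun x => G x i l) J) : LocSummableOn J (fun x => F x * G x) := by
  intro i l
  rw [locallyIntegrableOn_iff_intervalIntegrable hJ]
  intro a ha b hb
  simp only [Matrix.mul_apply]
  have := fun k => intervalIntegrable_mul_of_continuousOn
    (intervalIntegrable_of_locallyIntegrableOn hJ (hF i k) ha hb)
    ((hG k l).mono (hJ.uIcc_subset ha hb))
  simpa only [Finset.sum_fn] using! IntervalIntegrable.sum Finset.univ fun k _ => this k

theorem LocSummableOn.const_smul {F : ℝ → Matrix ι κ ℂ} (hF : LocSummableOn J F) (c : ℂ) :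
    LocSummableOn J (fun x => c • F x) :=
  fun i l => (hF i l).smul c

theorem LocSummableOn.sum {α : Type*} (s : Finset α) (hJ : J.OrdConnected)
    {F : α → ℝ → Matrix ι κ ℂ} (hF : ∀ k ∈ s, LocSummableOn J (F k)) :
    LocSummableOn J (fun x => ∑ k ∈ s, F k x) := by
  intro i l
  rw [locallyIntegrableOn_iff_intervalIntegrable hJ]
  intro a ha b hb
  simp only [Matrix.sum_apply]
  simpa only [Finset.sum_fn] using! IntervalIntegrable.sum s fun k hk =>
    intervalIntegrable_of_locallyIntegrableOn hJ (hF k hk i l) ha hb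

end LocSummable

/-! ### Calculus of Carathéodory derivatives. -/

namespace HasAEDerivOn

variable {ι κ μ : Type} {J : Set ℝ} {Y F : ℝ → Matrix ι κ ℂ}

theorem mono {I : Set ℝ} (h : HasAEDerivOn I Y F) (hJ : J ⊆ I) : HasAEDerivOn J Y F where
  ac i l a ha b hb := h.ac i l a (hJ ha) b (hJ hb)
  deriv := h.deriv.mono fun _ hx hxJ => hx (hJ hxJ)

theorem congr_deriv {F' : ℝ → Matrix ι κ ℂ} (h : HasAEDerivOn J Y F)
    (hF : ∀ x ∈ J, F' x = F x) : HasAEDerivOn J Y F' where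
  ac := h.ac
  deriv := h.deriv.mono fun x hx hxJ => by simpa only [hF x hxJ] using hx hxJ

theorem continuousOn (h : HasAEDerivOn J Y F) (i : ι) (l : κ) :
    ContinuousOn (fun x => Y x i l) J :=
  continuousOn_of_uIcc fun a ha b hb => (h.ac i l a ha b hb).continuousOn

theorem const (J : Set ℝ) (M : Matrix ι κ ℂ) : HasAEDerivOn J (fun _ => M) (fun _ => 0) where
  ac _ _ a _ b _ := absolutelyContinuousOnInterval_const _ a b
  deriv := Eventually.of_forall fun _ _ _ _ => hasDerivAt_const _ _

theorem add {Z G : ℝ → Matrix ι κ ℂ} (hY : HasAEDerivOn J Y F) (hZ : HasAEDerivOn J Z G) :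
    HasAEDerivOn J (fun x => Y x + Z x) (fun x => F x + G x) where
  ac i l a ha b hb := (hY.ac i l a ha b hb).add (hZ.ac i l a ha b hb)
  deriv := by
    filter_upwards [hY.deriv, hZ.deriv] with x h₁ h₂ hx i l
    exact (h₁ hx i l).add (h₂ hx i l)

theorem sub {Z G : ℝ → Matrix ι κ ℂ} (hY : HasAEDerivOn J Y F) (hZ : HasAEDerivOn J Z G) :
    HasAEDerivOn J (fun x => Y x - Z x) (fun x => F x - G x) where
  ac i l a ha b hb := (hY.ac i l a ha b hb).sub (hZ.ac i l a ha b hb)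
  deriv := by
    filter_upwards [hY.deriv, hZ.deriv] with x h₁ h₂ hx i l
    exact (h₁ hx i l).sub (h₂ hx i l)

theorem const_smul (hY : HasAEDerivOn J Y F) (c : ℂ) :
    HasAEDerivOn J (fun x => c • Y x) (fun x => c • F x) where
  ac i l a ha b hb := (hY.ac i l a ha b hb).const_smul c
  deriv := by
    filter_upwards [hY.deriv] with x h₁ hx i l
    exact (h₁ hx i l).const_smul c

theorem conjTranspose (hY : HasAEDerivOn J Y F) :
    HasAEDerivOn J (fun x => (Y x)ᴴ) (fun x => (F x)ᴴ) where
  ac i l a ha b hb := absolutelyContinuousOnInterval_of_dist_le_sum {()} (fun _ => 1)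
    (fun _ _ => hY.ac l i a ha b hb) fun u _ v _ => by
      rw [Finset.sum_singleton, one_mul, Matrix.conjTranspose_apply, Matrix.conjTranspose_apply,
        dist_eq_norm, dist_eq_norm, ← star_sub, norm_star]
  deriv := by
    filter_upwards [hY.deriv] with x h₁ hx i l
    exact (h₁ hx l i).star

theorem mul [Fintype κ] {Z G : ℝ → Matrix κ μ ℂ} (hY : HasAEDerivOn J Y F)
    (hZ : HasAEDerivOn J Z G) :
    HasAEDerivOn J (fun x => Y x * Z x) (fun x => F x * Z x + Y x * G x) where
  ac i l a ha b hb := by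
    simp only [Matrix.mul_apply]
    have h : ∀ k ∈ Finset.univ, AbsolutelyContinuousOnInterval (fun x => Y x i k * Z x k l) a b :=
      fun k _ => (hY.ac i k a ha b hb).smul (hZ.ac k l a ha b hb)
    refine absolutelyContinuousOnInterval_of_dist_le_sum Finset.univ (fun _ => 1) h
      fun u _ v _ => ?_
    simpa using dist_sum_sum_le _ _ _
  deriv := by
    filter_upwards [hY.deriv, hZ.deriv] with x h₁ h₂ hx i l
    simp only [Matrix.mul_apply, Matrix.add_apply, ← Finset.sum_add_distrib]
    exact HasDerivAt.fun_sum fun k _ => (h₁ hx i k).mul (h₂ hx k l)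

theorem const_mul [Fintype ι] (M : Matrix μ ι ℂ) (hY : HasAEDerivOn J Y F) :
    HasAEDerivOn J (fun x => M * Y x) (fun x => M * F x) := by
  simpa using (const J M).mul hY

theorem mul_const [Fintype κ] (hY : HasAEDerivOn J Y F) (M : Matrix κ μ ℂ) :
    HasAEDerivOn J (fun x => Y x * M) (fun x => F x * M) := by
  simpa using hY.mul (const J M)

theorem eq_of_deriv_eq_zero (hJ : J.OrdConnected) (hY : HasAEDerivOn J Y F)
    (hF : ∀ x ∈ J, F x = 0) {a b : ℝ} (ha : a ∈ J) (hb : b ∈ J) : Y a = Y b := by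
  ext i l
  obtain ⟨C, hC⟩ := (hY.ac i l a ha b hb).const_of_ae_hasDerivAt_zero <| by
    filter_upwards [hY.deriv] with x h hx
    have hxJ := hJ.uIcc_subset ha hb hx
    simpa only [hF x hxJ] using! h hxJ i l
  rw [hC a left_mem_uIcc, hC b right_mem_uIcc]

theorem eqOn_of_deriv_eq (hJ : J.OrdConnected) {Z : ℝ → Matrix ι κ ℂ} {G : ℝ → Matrix ι κ ℂ}
    (hY : HasAEDerivOn J Y F) (hZ : HasAEDerivOn J Z G) (hFG : ∀ x ∈ J, F x = G x) {a : ℝ}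
    (ha : a ∈ J) (h : Y a = Z a) : EqOn Y Z J := by
  intro x hx
  have := eq_of_deriv_eq_zero hJ (hY.sub hZ) (fun x hx => sub_eq_zero.2 (hFG x hx)) ha hx
  rw [h, sub_self] at this
  exact sub_eq_zero.1 this.symm

theorem _root_.GBDT.LocSummableOn.exists_primitive [Countable ι] [Countable κ]
    (hJ : J.OrdConnected) (hF : LocSummableOn J F) {a : ℝ} (ha : a ∈ J)
    (M : Matrix ι κ ℂ) : ∃ Y : ℝ → Matrix ι κ ℂ, Y a = M ∧ HasAEDerivOn J Y F := by
  refine ⟨fun x => Matrix.of fun i l => M i l + ∫ t in a..x, F t i l, ?_, ?_, ?_⟩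
  · ext i l
    simp
  · intro i l b hb c hc
    have hint := fun b hb c hc => intervalIntegrable_of_locallyIntegrableOn (a := b) (b := c)
      hJ (hF i l) hb hc
    -- The integral is rebased at `b`, since `a` need not lie in `[b, c]`.
    refine ((absolutelyContinuousOnInterval_integral (hint b hb c hc)).add
      (absolutelyContinuousOnInterval_const (M i l + ∫ t in a..b, F t i l) b c)).congr
      fun x hx => ?_
    have := intervalIntegral.integral_add_adjacent_intervals (hint a ha b hb)
      (hint b hb x (hJ.uIcc_subset hb hc hx))
    simp only [Matrix.of_apply, Pi.add_apply, ← this]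
    ring
  · have h : ∀ i l, ∀ᵐ x : ℝ, x ∈ J →
        HasDerivAt (fun x => ∫ t in a..x, F t i l) (F x i l) x := fun i l =>
      ae_hasDerivAt_integral_of_intervalIntegrable ha fun b hb c hc =>
        intervalIntegrable_of_locallyIntegrableOn hJ (hF i l) hb hc
    filter_upwards [ae_all_iff.2 fun i => ae_all_iff.2 (h i)] with x hx hxJ i l
    exact (hx i l hxJ).const_add _

section Square

open scoped Matrix.Norms.Operator

variable {ι : Type} [Fintype ι] [DecidableEq ι] {J : Set ℝ} {Y F : ℝ → Matrix ι ι ℂ}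

/-- The entry at `(i, l)` as a continuous linear map. -/
def entryCLM (i l : ι) : Matrix ι ι ℂ →L[ℝ] ℂ :=
  (Matrix.entryLinearMap ℝ ℂ i l).toContinuousLinearMap

/-- The embedding of the entry at `(i, l)` as a continuous linear map. -/
def singleCLM (i l : ι) : ℂ →L[ℝ] Matrix ι ι ℂ :=
  (Matrix.singleLinearMap ℝ i l).toContinuousLinearMap

theorem sum_singleCLM (M : Matrix ι ι ℂ) : ∑ i, ∑ l, singleCLM i l (M i l) = M :=
  (Matrix.matrix_eq_sum_single M).symm

theorem hasDerivAt_matrix_iff {Y : ℝ → Matrix ι ι ℂ} {M : Matrix ι ι ℂ} {x : ℝ} :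
    HasDerivAt Y M x ↔ ∀ i l, HasDerivAt (fun t => Y t i l) (M i l) x := by
  refine ⟨fun h i l => (entryCLM i l).hasFDerivAt.comp_hasDerivAt x h, fun h => ?_⟩
  have := HasDerivAt.fun_sum (u := Finset.univ) fun i _ => HasDerivAt.fun_sum (u := Finset.univ)
    fun l _ => (singleCLM i l).hasFDerivAt.comp_hasDerivAt x (h i l)
  refine (this.congr_deriv (sum_singleCLM M)).congr_of_eventuallyEq (Eventually.of_forall ?_)
  exact fun t => (sum_singleCLM (Y t)).symm

/-- Absolute continuity comes from `U⁻¹ - V⁻¹ = U⁻¹ (V - U) V⁻¹`: the entries of the inverse are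
continuous, hence bounded on a compact interval, so their increments are controlled by those of `Y`.
The derivative is that of inversion in a Banach algebra. -/
theorem inv (hJ : J.OrdConnected) (hY : HasAEDerivOn J Y F) (hu : ∀ x ∈ J, IsUnit (Y x)) :
    HasAEDerivOn J (fun x => (Y x)⁻¹) (fun x => -((Y x)⁻¹ * F x * (Y x)⁻¹)) where
  ac i l a ha b hb := by
    have hsub := hJ.uIcc_subset ha hb
    have hYc : ContinuousOn Y (uIcc a b) := by
      refine continuousOn_pi.2 fun i => continuousOn_pi.2 fun l => (hY.continuousOn i l).mono hsub
    have hc : ∀ i l, ContinuousOn (fun x => (Y x)⁻¹ i l) (uIcc a b) := by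
      intro i l x hx
      have hdet : ContinuousAt Ring.inverse (Y x).det :=
        NormedRing.inverse_continuousAt ((Matrix.isUnit_iff_isUnit_det _).1 (hu x (hsub hx))).unit
      exact ((entryCLM i l).continuous.continuousAt.comp
        (continuousAt_matrix_inv _ hdet)).comp_continuousWithinAt (hYc x hx)
    choose C hC using fun i l => isCompact_uIcc.exists_bound_of_continuousOn (hc i l)
    refine absolutelyContinuousOnInterval_of_dist_le_sum (Finset.univ : Finset (ι × ι))
      (g := fun p x => Y x p.1 p.2) (fun p => C i p.1 * C p.2 l)
      (fun p _ => hY.ac p.1 p.2 a ha b hb) fun u hu' v hv' => ?_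
    have key : (Y u)⁻¹ - (Y v)⁻¹ = (Y u)⁻¹ * (Y v - Y u) * (Y v)⁻¹ := by
      have h1 := Matrix.nonsing_inv_mul _ ((Matrix.isUnit_iff_isUnit_det _).1 (hu u (hsub hu')))
      have h2 := Matrix.mul_nonsing_inv _ ((Matrix.isUnit_iff_isUnit_det _).1 (hu v (hsub hv')))
      rw [mul_sub, sub_mul, h1, one_mul, mul_assoc, h2, mul_one]
    have key' : (Y u)⁻¹ i l - (Y v)⁻¹ i l =
        ∑ p : ι × ι, (Y u)⁻¹ i p.1 * (Y v p.1 p.2 - Y u p.1 p.2) * (Y v)⁻¹ p.2 l := by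
      rw [← Matrix.sub_apply, key, Matrix.mul_apply, Fintype.sum_prod_type_right]
      refine Finset.sum_congr rfl fun k _ => ?_
      rw [Matrix.mul_apply, Finset.sum_mul]
      rfl
    rw [dist_eq_norm, key']
    refine (norm_sum_le _ _).trans (Finset.sum_le_sum fun p _ => ?_)
    rw [norm_mul, norm_mul, dist_comm, dist_eq_norm]
    have h1 := hC i p.1 u hu'
    have h2 := hC p.2 l v hv'
    have h3 : 0 ≤ C i p.1 := (norm_nonneg _).trans h1
    calc _ ≤ C i p.1 * ‖Y v p.1 p.2 - Y u p.1 p.2‖ * C p.2 l := by gcongr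
      _ = _ := by ring
  deriv := by
    filter_upwards [hY.deriv] with x h hx
    obtain ⟨u, hu'⟩ := hu x hx
    have h1 : HasDerivAt Y (F x) x := hasDerivAt_matrix_iff.2 (h hx)
    have h2 : HasFDerivAt Ring.inverse
      (-ContinuousLinearMap.mulLeftRight ℝ (Matrix ι ι ℂ) ↑u⁻¹ ↑u⁻¹) (Y x) := by
      rw [← hu']
      exact hasFDerivAt_ringInverse u
    have h3 := h2.comp_hasDerivAt x h1
    have h4 : (↑u⁻¹ : Matrix ι ι ℂ) = (Y x)⁻¹ := by
      rw [Matrix.nonsing_inv_eq_ringInverse, ← hu', Ring.inverse_unit]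
    have h5 : HasDerivAt (fun t => (Y t)⁻¹) (-((Y x)⁻¹ * F x * (Y x)⁻¹)) x := by
      simpa only [Matrix.nonsing_inv_eq_ringInverse, Function.comp_def, h4,
        neg_apply, ContinuousLinearMap.mulLeftRight_apply] using! h3
    exact hasDerivAt_matrix_iff.1 h5

end Square

end HasAEDerivOn

/-! ### Linear systems: existence and uniqueness. -/

section LinearODE

open HasAEDerivOn

variable {ι κ : Type} [Fintype ι] [DecidableEq ι] {I : Set ℝ} {L : ℝ → Matrix ι ι ℂ} {a : ℝ}

/-- The hypotheses and conclusion are entrywise and involve no matrix norm. Norms live only on the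
copy `𝔸`; finite dimension makes the passage between entries and `𝔸` continuous. -/
theorem exists_normalized_fundamentalSolution_of_algEquiv {𝔸 : Type*} [NormedRing 𝔸]
    [NormedAlgebra ℝ 𝔸] (e : 𝔸 ≃ₐ[ℝ] Matrix ι ι ℂ) (hI : I.OrdConnected) (ha : a ∈ I)
    (hL : LocSummableOn I L) :
    ∃ U : ℝ → Matrix ι ι ℂ, U a = 1 ∧ IsMatrixSolution I L U := by
  have : FiniteDimensional ℝ 𝔸 := e.symm.toLinearEquiv.finiteDimensional
  have : CompleteSpace 𝔸 := FiniteDimensional.complete ℝ 𝔸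
  let ent (i l : ι) : 𝔸 →L[ℝ] ℂ :=
    ((Matrix.entryLinearMap ℝ ℂ i l) ∘ₗ e.toLinearMap).toContinuousLinearMap
  let sgl (i l : ι) : ℂ →L[ℝ] 𝔸 :=
    (e.symm.toLinearMap ∘ₗ (Matrix.singleLinearMap ℝ i l)).toContinuousLinearMap
  have hent : ∀ i l x, ent i l x = e x i l := fun i l x => rfl
  have hsgl : ∀ M : Matrix ι ι ℂ, ∑ i, ∑ l, sgl i l (M i l) = e.symm M := by
    intro M
    conv_rhs => rw [Matrix.matrix_eq_sum_single M]
    simp only [map_sum]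
    rfl
  have hLi : LocallyIntegrableOn (fun t => e.symm (L t)) I := by
    rw [locallyIntegrableOn_iff_intervalIntegrable hI]
    intro b hb c hc
    have h : ∀ i l, IntervalIntegrable (fun t => sgl i l (L t i l)) volume b c := fun i l =>
      intervalIntegrable_of_locallyIntegrableOn hI
        ((sgl i l).locallyIntegrableOn_comp (hL i l)) hb hc
    have := IntervalIntegrable.sum Finset.univ fun i _ =>
      IntervalIntegrable.sum Finset.univ fun l _ => h i l
    simpa only [Finset.sum_fn, hsgl] using! this
  obtain ⟨U, hint, hU⟩ := exists_integral_equation_solution hI ha hLi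
  -- The integral formula is used instead of `U`, because `HasDerivAt` sees a full neighbourhood
  -- while the integral equation holds only on `I`.
  refine ⟨fun x => e (1 + ∫ t in a..x, e.symm (L t) * U t), by simp, ?_, ?_⟩
  · intro i l b hb c hc
    have h1 := absolutelyContinuousOnInterval_integral (hint b hb c hc)
    refine absolutelyContinuousOnInterval_of_dist_le_sum {()} (fun _ => ‖ent i l‖)
      (fun _ _ => h1) fun u hu v hv => ?_
    have hsub := hI.uIcc_subset hb hc
    simp only [Finset.sum_singleton, dist_eq_norm]
    rw [intervalIntegral.integral_interval_sub_left (hint b hb u (hsub hu))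
      (hint b hb v (hsub hv)), ← intervalIntegral.integral_interval_sub_left
      (hint a ha u (hsub hu)) (hint a ha v (hsub hv)),
      ← add_sub_add_left_eq_sub _ _ (1 : 𝔸), ← hent, ← hent, ← map_sub]
    exact (ent i l).le_opNorm _
  · filter_upwards [ae_hasDerivAt_integral_of_intervalIntegrable ha hint] with x hx hxI i l
    have h := (ent i l).hasFDerivAt.comp_hasDerivAt x ((hx hxI).const_add 1)
    rw [← hU x hxI]
    simpa only [hent, Function.comp_def, map_mul, AlgEquiv.apply_symm_apply] using! h

theorem exists_normalized_fundamentalSolution (hI : I.OrdConnected) (ha : a ∈ I)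
    (hL : LocSummableOn I L) :
    ∃ U : ℝ → Matrix ι ι ℂ, U a = 1 ∧ IsMatrixSolution I L U :=
  letI : NormedRing (Matrix ι ι ℂ) := Matrix.linftyOpNormedRing
  letI : NormedAlgebra ℝ (Matrix ι ι ℂ) := Matrix.linftyOpNormedAlgebra
  exists_normalized_fundamentalSolution_of_algEquiv (𝔸 := Matrix ι ι ℂ) AlgEquiv.refl hI ha hL

theorem exists_linear_solution (hI : I.OrdConnected) (ha : a ∈ I) (hL : LocSummableOn I L)
    (M : Matrix ι κ ℂ) :
    ∃ Y : ℝ → Matrix ι κ ℂ, Y a = M ∧ HasAEDerivOn I Y (fun x => L x * Y x) := by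
  obtain ⟨U, hUa, hU⟩ := exists_normalized_fundamentalSolution hI ha hL
  refine ⟨fun x => U x * M, by simp [hUa], (HasAEDerivOn.mul_const hU M).congr_deriv
    fun x _ => (Matrix.mul_assoc _ _ _).symm⟩

theorem LocSummableOn.transpose {ι κ : Type} {F : ℝ → Matrix ι κ ℂ} (hF : LocSummableOn I F) :
    LocSummableOn I (fun x => (F x)ᵀ) :=
  fun i l => hF l i

theorem HasAEDerivOn.transpose {ι κ : Type} {Y F : ℝ → Matrix ι κ ℂ} (hY : HasAEDerivOn I Y F) :
    HasAEDerivOn I (fun x => (Y x)ᵀ) (fun x => (F x)ᵀ) where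
  ac i l := hY.ac l i
  deriv := hY.deriv.mono fun _ h hx i l => h hx l i

/-- A solution vanishing at one point vanishes identically: pair it with the solution of the
adjoint equation that is normalized at the point under consideration. -/
theorem linear_solution_eq_zero (hI : I.OrdConnected) (ha : a ∈ I) (hL : LocSummableOn I L)
    {Y : ℝ → Matrix ι κ ℂ} (hY : HasAEDerivOn I Y (fun x => L x * Y x)) (hYa : Y a = 0)
    {b : ℝ} (hb : b ∈ I) : Y b = 0 := by
  obtain ⟨V, hVb, hV⟩ := exists_normalized_fundamentalSolution hI hb (hL.transpose.const_smul (-1))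
  -- With `V' = -Lᵀ V`, the product `Vᵀ Y` has zero derivative; it vanishes at `a` and equals `Y b`
  -- at `b`.
  have h := (HasAEDerivOn.transpose hV).mul hY
  have := h.eq_of_deriv_eq_zero hI (fun x _ => by simp [Matrix.mul_assoc]) ha hb
  simpa [hVb, hYa] using this.symm

theorem linear_solution_eqOn (hI : I.OrdConnected) (ha : a ∈ I) (hL : LocSummableOn I L)
    {Y Z : ℝ → Matrix ι κ ℂ} (hY : HasAEDerivOn I Y (fun x => L x * Y x))
    (hZ : HasAEDerivOn I Z (fun x => L x * Z x)) (h : Y a = Z a) : EqOn Y Z I := by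
  intro x hx
  refine sub_eq_zero.1 (linear_solution_eq_zero hI ha hL ((hY.sub hZ).congr_deriv fun x _ => ?_)
    (sub_eq_zero.2 h) hx)
  rw [Matrix.mul_sub]

end LinearODE

/-! ### Two-sided linear equations by vectorization. -/

section Sandwich

variable {α ν ι : Type} [Fintype α] {I : Set ℝ}
  {A : α → Matrix ν ν ℂ} {N : α → ℝ → Matrix ι ι ℂ} {a : ℝ}

/-- A matrix as a single column indexed by the pairs of indices. -/
def toColumn (M : Matrix ν ι ℂ) : Matrix (ν × ι) Unit ℂ :=
  Matrix.of fun p _ => M p.1 p.2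

/-- The coefficient of the column form of `P ↦ ∑ₖ Aₖ P Nₖ`. -/
def sandwichCoeff (A : α → Matrix ν ν ℂ) (N : α → Matrix ι ι ℂ) : Matrix (ν × ι) (ν × ι) ℂ :=
  ∑ k, Matrix.of fun p q => A k p.1 q.1 * N k q.2 p.2

/-- This is the Kronecker rule `vec (A M N) = (A ⊗ Nᵀ) vec M`, summed over `k`. -/
theorem sandwichCoeff_mul_toColumn [Fintype ν] [Fintype ι] (A : α → Matrix ν ν ℂ)
    (N : α → Matrix ι ι ℂ)
    (M : Matrix ν ι ℂ) :
    sandwichCoeff A N * toColumn M = toColumn (∑ k, A k * M * N k) := by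
  ext p u
  simp only [sandwichCoeff, toColumn, Matrix.sum_mul, Matrix.sum_apply, Matrix.of_apply]
  refine Finset.sum_congr rfl fun k _ => ?_
  simp only [Matrix.mul_apply, Matrix.of_apply, Fintype.sum_prod_type_right, Finset.sum_mul]
  refine Finset.sum_congr rfl fun d _ => Finset.sum_congr rfl fun c _ => ?_
  ring

theorem locSummableOn_sandwichCoeff (hI : I.OrdConnected) (hN : ∀ k, LocSummableOn I (N k)) :
    LocSummableOn I (fun x => sandwichCoeff A (fun k => N k x)) :=
  LocSummableOn.sum _ hI fun k _ p q => (hN k q.2 p.2).smul (A k p.1 q.1)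

theorem hasAEDerivOn_toColumn_iff {P F : ℝ → Matrix ν ι ℂ} :
    HasAEDerivOn I (fun x => toColumn (P x)) (fun x => toColumn (F x)) ↔ HasAEDerivOn I P F :=
  ⟨fun h => ⟨fun i l => h.ac (i, l) (), h.deriv.mono fun _ hx hxI i l => hx hxI (i, l) ()⟩,
    fun h => ⟨fun p _ => h.ac p.1 p.2, h.deriv.mono fun _ hx hxI p _ => hx hxI p.1 p.2⟩⟩

theorem exists_sandwich_solution [Fintype ν] [DecidableEq ν] [Fintype ι] [DecidableEq ι]
    (hI : I.OrdConnected) (ha : a ∈ I)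
    (hN : ∀ k, LocSummableOn I (N k)) (M : Matrix ν ι ℂ) :
    ∃ P : ℝ → Matrix ν ι ℂ, P a = M ∧ HasAEDerivOn I P (fun x => ∑ k, A k * P x * N k x) := by
  obtain ⟨Y, hYa, hY⟩ := exists_linear_solution hI ha
    (locSummableOn_sandwichCoeff (A := A) hI hN) (toColumn M)
  have hcol : ∀ x, toColumn (Matrix.of fun i l => Y x (i, l) ()) = Y x := fun x => rfl
  refine ⟨fun x => Matrix.of fun i l => Y x (i, l) (), ?_, ?_⟩
  · ext i l
    exact congrFun (congrFun hYa (i, l)) ()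
  rw [← hasAEDerivOn_toColumn_iff]
  simpa only [← sandwichCoeff_mul_toColumn, hcol] using hY

theorem sandwich_solution_eqOn [Fintype ν] [DecidableEq ν] [Fintype ι] [DecidableEq ι]
    (hI : I.OrdConnected) (ha : a ∈ I)
    (hN : ∀ k, LocSummableOn I (N k)) {P Q : ℝ → Matrix ν ι ℂ}
    (hP : HasAEDerivOn I P (fun x => ∑ k, A k * P x * N k x))
    (hQ : HasAEDerivOn I Q (fun x => ∑ k, A k * Q x * N k x)) (h : P a = Q a) : EqOn P Q I := by
  rw [← hasAEDerivOn_toColumn_iff] at hP hQ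
  simp only [← sandwichCoeff_mul_toColumn] at hP hQ
  intro x hx
  have := linear_solution_eqOn hI ha (locSummableOn_sandwichCoeff (A := A) hI hN) hP hQ
    (congrArg toColumn h) hx
  ext i l
  exact congrFun (congrFun this (i, l)) ()

end Sandwich

/-! ### The flow of `Π` and `S` and its invariants. -/

section NodeFlow

variable {r m₁ m₂ p n : ℕ} {I : Set ℝ} {c : Fin r → ℝ}
  {β : Fin r → ℝ → Matrix (Fin p) (Fin m₁ ⊕ Fin m₂) ℂ}
  {A S₀ : Matrix (Fin n) (Fin n) ℂ} {P₀ : Matrix (Fin n) (Fin m₁ ⊕ Fin m₂) ℂ}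
  {P : ℝ → Matrix (Fin n) (Fin m₁ ⊕ Fin m₂) ℂ} {S : ℝ → Matrix (Fin n) (Fin n) ℂ}

theorem node_coeff_eq (P : Matrix (Fin n) (Fin m₁ ⊕ Fin m₂) ℂ) (x : ℝ) :
    (-Complex.I) • ∑ k, res A (c k) * P * sig m₁ m₂ * ((β k x)ᴴ * β k x) =
      ∑ k, ((-Complex.I) • res A (c k)) * P * (sig m₁ m₂ * ((β k x)ᴴ * β k x)) := by
  simp only [Finset.smul_sum, Matrix.mul_assoc, Matrix.smul_mul]

theorem locSummableOn_sig_mul (hI : I.OrdConnected)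
    (hβ : ∀ k, LocSummableOn I (fun x => (β k x)ᴴ * β k x)) (k : Fin r) :
    LocSummableOn I (fun x => sig m₁ m₂ * ((β k x)ᴴ * β k x)) :=
  LocSummableOn.continuousOn_mul hI (fun _ _ => continuousOn_const) (hβ k)

theorem exists_isNodeFlow (hI : I.OrdConnected) (h0 : (0 : ℝ) ∈ I)
    (hβ : ∀ k, LocSummableOn I (fun x => (β k x)ᴴ * β k x)) :
    ∃ P S, IsNodeFlow I c β A S₀ P₀ P S := by
  obtain ⟨P, hP0, hP⟩ := exists_sandwich_solution (A := fun k => (-Complex.I) • res A (c k)) hI h0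
    (locSummableOn_sig_mul hI hβ) P₀
  have hSsum : LocSummableOn I (fun x => -∑ k, res A (c k) * P x * sig m₁ m₂ *
      ((β k x)ᴴ * β k x) * sig m₁ m₂ * (P x)ᴴ * res Aᴴ (c k)) := by
    have h : LocSummableOn I (fun x => (-1 : ℂ) • ∑ k, (res A (c k) * P x * sig m₁ m₂) *
        ((β k x)ᴴ * β k x) * (sig m₁ m₂ * (P x)ᴴ * res Aᴴ (c k))) := by
      refine LocSummableOn.const_smul (LocSummableOn.sum _ hI fun k _ => ?_) _
      exact ((hβ k).continuousOn_mul hI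
        ((hP.const_mul _).mul_const _).continuousOn).mul_continuousOn hI
        ((hP.conjTranspose.const_mul _).mul_const _).continuousOn
    simpa only [neg_smul, one_smul, Matrix.mul_assoc] using h
  obtain ⟨S, hS0, hS⟩ := hSsum.exists_primitive hI h0 S₀
  exact ⟨P, S, hP0, hS0, hP.congr_deriv fun x _ => node_coeff_eq _ _, hS⟩

theorem IsNodeFlow.unique (hI : I.OrdConnected) (h0 : (0 : ℝ) ∈ I)
    (hβ : ∀ k, LocSummableOn I (fun x => (β k x)ᴴ * β k x))
    {P' : ℝ → Matrix (Fin n) (Fin m₁ ⊕ Fin m₂) ℂ} {S' : ℝ → Matrix (Fin n) (Fin n) ℂ}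
    (h' : IsNodeFlow I c β A S₀ P₀ P' S') (h : IsNodeFlow I c β A S₀ P₀ P S) :
    EqOn P' P I ∧ EqOn S' S I := by
  have hP : EqOn P' P I :=
    sandwich_solution_eqOn (A := fun k => (-Complex.I) • res A (c k)) hI h0
      (locSummableOn_sig_mul hI hβ) (h'.P_eqn.congr_deriv fun x _ => (node_coeff_eq _ _).symm)
      (h.P_eqn.congr_deriv fun x _ => (node_coeff_eq _ _).symm) (h'.P_zero.trans h.P_zero.symm)
  exact ⟨hP, h'.S_eqn.eqOn_of_deriv_eq hI h.S_eqn (fun x hx => by rw [hP hx]) h0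
    (h'.S_zero.trans h.S_zero.symm)⟩

@[simp]
theorem sig_conjTranspose : (sig m₁ m₂)ᴴ = sig m₁ m₂ := by
  simp [sig, Matrix.fromBlocks_conjTranspose]

@[simp]
theorem sig_mul_sig : sig m₁ m₂ * sig m₁ m₂ = 1 := by
  simp [sig, Matrix.fromBlocks_multiply]

theorem res_conjTranspose (A : Matrix (Fin n) (Fin n) ℂ) (z : ℂ) :
    (res A z)ᴴ = res Aᴴ (star z) := by
  simp [res, Matrix.conjTranspose_nonsing_inv]

theorem isUnit_sub_smul {z : ℂ} (hz : z ∉ spectrum ℂ A) : IsUnit (A - z • 1) := by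
  rw [spectrum.notMem_iff, Algebra.algebraMap_eq_smul_one, ← IsUnit.neg_iff, neg_sub] at hz
  exact hz

theorem sub_smul_mul_res {z : ℂ} (hz : z ∉ spectrum ℂ A) : (A - z • 1) * res A z = 1 :=
  Matrix.mul_nonsing_inv _ ((Matrix.isUnit_iff_isUnit_det _).1 (isUnit_sub_smul hz))

theorem res_mul_sub_smul {z : ℂ} (hz : z ∉ spectrum ℂ A) : res A z * (A - z • 1) = 1 :=
  Matrix.nonsing_inv_mul _ ((Matrix.isUnit_iff_isUnit_det _).1 (isUnit_sub_smul hz))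

theorem mul_res {z : ℂ} (hz : z ∉ spectrum ℂ A) : A * res A z = 1 + z • res A z := by
  rw [← sub_smul_mul_res hz, sub_mul, Matrix.smul_mul, one_mul, sub_add_cancel]

theorem res_mul {z : ℂ} (hz : z ∉ spectrum ℂ A) : res A z * A = 1 + z • res A z := by
  rw [← res_mul_sub_smul hz, mul_sub, Matrix.mul_smul, mul_one, sub_add_cancel]

theorem res_sub_res {z w : ℂ} (hz : z ∉ spectrum ℂ A) (hw : w ∉ spectrum ℂ A) :
    res A w - res A z = (w - z) • (res A z * res A w) := by
  have h : res A z * (A - z • 1) * res A w - res A z * ((A - w • 1) * res A w) =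
      (w - z) • (res A z * res A w) := by
    rw [Matrix.mul_assoc, ← Matrix.mul_sub, ← Matrix.sub_mul, sub_sub_sub_cancel_left, ← sub_smul,
      Matrix.smul_mul, one_mul, Matrix.mul_smul]
  rw [← h, res_mul_sub_smul hz, sub_smul_mul_res hw, one_mul, mul_one]

theorem star_notMem_spectrum_conjTranspose {z : ℂ} (hz : z ∉ spectrum ℂ A) :
    star z ∉ spectrum ℂ Aᴴ := by
  have h : z ∈ resolventSet ℂ A := not_not.1 hz
  rw [← star_star A] at h
  exact not_not.2 (spectrum.star_mem_resolventSet_iff.2 h)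

theorem IsNodeFlow.isHermitian (hI : I.OrdConnected) (h0 : (0 : ℝ) ∈ I) (hS₀ : S₀ᴴ = S₀)
    (h : IsNodeFlow I c β A S₀ P₀ P S) {x : ℝ} (hx : x ∈ I) : (S x)ᴴ = S x := by
  refine h.S_eqn.conjTranspose.eqOn_of_deriv_eq hI h.S_eqn (fun x _ => ?_) h0
    (by rw [h.S_zero, hS₀]) hx
  simp only [Matrix.conjTranspose_neg, Matrix.conjTranspose_sum, Matrix.conjTranspose_mul,
    Matrix.conjTranspose_conjTranspose, res_conjTranspose, sig_conjTranspose, Matrix.mul_assoc,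
    RCLike.star_def, Complex.conj_ofReal]

/-- Write `R = res A (c k)` and `X = Π j H j Πᴴ`. By `A R = 1 + c R` and its adjoint, the `k`-th
term of `A S' - S' Aᴴ` is `R X - X Rᴴ`, the `c R X Rᴴ` terms cancelling. The equation for `Π` gives
the same term on the right. -/
theorem IsNodeFlow.node_identity (hI : I.OrdConnected) (h0 : (0 : ℝ) ∈ I)
    (hcA : ∀ k, (c k : ℂ) ∉ spectrum ℂ A)
    (hnode : A * S₀ - S₀ * Aᴴ = Complex.I • (P₀ * sig m₁ m₂ * P₀ᴴ))
    (h : IsNodeFlow I c β A S₀ P₀ P S) {x : ℝ} (hx : x ∈ I) :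
    A * S x - S x * Aᴴ = Complex.I • (P x * sig m₁ m₂ * (P x)ᴴ) := by
  have hcA' : ∀ k, (c k : ℂ) ∉ spectrum ℂ Aᴴ := fun k => by
    simpa using star_notMem_spectrum_conjTranspose (hcA k)
  refine ((h.S_eqn.const_mul A).sub (h.S_eqn.mul_const Aᴴ)).eqOn_of_deriv_eq hI
    (((h.P_eqn.mul_const _).mul h.P_eqn.conjTranspose).const_smul _) (fun x _ => ?_) h0
    (by rw [h.S_zero, h.P_zero, hnode]) hx
  simp only [Matrix.conjTranspose_smul, Matrix.conjTranspose_sum, Matrix.conjTranspose_mul,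
    Matrix.conjTranspose_conjTranspose, res_conjTranspose, sig_conjTranspose,
    RCLike.star_def, Complex.conj_ofReal, Finset.smul_sum, Matrix.mul_sum, Matrix.sum_mul,
    ← Finset.sum_neg_distrib, ← Finset.sum_sub_distrib, ← Finset.sum_add_distrib]
  refine Finset.sum_congr rfl fun k _ => ?_
  have h1 := mul_res (hcA k)
  have h2 := res_mul (hcA' k)
  have h1' : ∀ X : Matrix (Fin n) (Fin n) ℂ,
      A * (res A (c k) * X) = X + (c k : ℂ) • (res A (c k) * X) := fun X => by
    rw [← Matrix.mul_assoc, h1, Matrix.add_mul, Matrix.one_mul, Matrix.smul_mul]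
  simp only [Matrix.mul_assoc, Matrix.neg_mul, h1', h2, Matrix.mul_add,
    Matrix.mul_smul, Matrix.smul_mul, Matrix.mul_one, smul_smul, smul_add, map_neg, mul_neg,
    neg_smul, smul_neg, Complex.conj_I, Complex.I_mul_I, neg_neg, one_smul]
  abel

end NodeFlow

/-! ### Pointwise algebra of the transfer function. -/

section Pointwise

variable {r m₁ m₂ p n : ℕ} {A : Matrix (Fin n) (Fin n) ℂ}
  {P : ℝ → Matrix (Fin n) (Fin m₁ ⊕ Fin m₂) ℂ} {S : ℝ → Matrix (Fin n) (Fin n) ℂ} {x : ℝ}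

/-- The factor `I_m + i j Π^* (A^* - z)⁻¹ S⁻¹ Π`, inverse to the transfer function at `z`. -/
def cotransfer (A : Matrix (Fin n) (Fin n) ℂ) (P : ℝ → Matrix (Fin n) (Fin m₁ ⊕ Fin m₂) ℂ)
    (S : ℝ → Matrix (Fin n) (Fin n) ℂ) (z : ℂ) (x : ℝ) :
    Matrix (Fin m₁ ⊕ Fin m₂) (Fin m₁ ⊕ Fin m₂) ℂ :=
  1 + Complex.I • (sig m₁ m₂ * (P x)ᴴ * res Aᴴ z * (S x)⁻¹ * P x)

theorem sig_mul_transfer_conjTranspose_mul_sig (hS : (S x)ᴴ = S x) (z : ℂ) :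
    sig m₁ m₂ * (transfer A P S z x)ᴴ * sig m₁ m₂ = cotransfer A P S (star z) x := by
  simp only [transfer, cotransfer, Matrix.conjTranspose_sub, Matrix.conjTranspose_one,
    Matrix.conjTranspose_smul, Matrix.conjTranspose_mul, Matrix.conjTranspose_conjTranspose,
    Matrix.conjTranspose_nonsing_inv, hS, res_conjTranspose, sig_conjTranspose, Matrix.mul_add,
    Matrix.add_mul, Matrix.mul_one, Matrix.mul_smul, Matrix.smul_mul,
    Matrix.mul_assoc, sig_mul_sig, RCLike.star_def, Complex.conj_I, neg_smul, sub_neg_eq_add]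

/-- The node identity multiplied by `S⁻¹` on both sides, in the shape of the quadratic term of
`cotransfer * transfer`. -/
theorem inv_mul_node_mul_inv (hu : IsUnit (S x))
    (hnode : A * S x - S x * Aᴴ = Complex.I • (P x * sig m₁ m₂ * (P x)ᴴ)) :
    Complex.I • ((S x)⁻¹ * (P x * (sig m₁ m₂ * ((P x)ᴴ * (S x)⁻¹)))) =
      (S x)⁻¹ * A - Aᴴ * (S x)⁻¹ := by
  have hdet := (Matrix.isUnit_iff_isUnit_det _).1 hu
  have h : (S x)⁻¹ * (A * S x - S x * Aᴴ) * (S x)⁻¹ = (S x)⁻¹ * A - Aᴴ * (S x)⁻¹ := by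
    rw [Matrix.mul_sub, Matrix.sub_mul, ← Matrix.mul_assoc, ← Matrix.mul_assoc,
      Matrix.mul_nonsing_inv_cancel_right _ _ hdet, Matrix.nonsing_inv_mul _ hdet, Matrix.one_mul]
  rw [← h, hnode]
  simp only [Matrix.mul_smul, Matrix.smul_mul, Matrix.mul_assoc]

theorem cotransfer_mul_transfer (hu : IsUnit (S x))
    (hnode : A * S x - S x * Aᴴ = Complex.I • (P x * sig m₁ m₂ * (P x)ᴴ)) {z w : ℂ}
    (hz : z ∉ spectrum ℂ A) (hw : w ∉ spectrum ℂ Aᴴ) :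
    cotransfer A P S w x * transfer A P S z x =
      1 - ((z - w) * Complex.I) •
        (sig m₁ m₂ * (P x)ᴴ * res Aᴴ w * (S x)⁻¹ * res A z * P x) := by
  have h1 := inv_mul_node_mul_inv hu hnode
  have h2 := mul_res hz
  have h3 := res_mul hw
  -- Between the resolvents, `S⁻¹ A - Aᴴ S⁻¹` splits by `A R = 1 + z R` and `R' Aᴴ = 1 + w R'`. The
  -- two terms with a single resolvent cancel the linear terms of the product.
  have h4 : Complex.I • (res Aᴴ w * ((S x)⁻¹ * (P x * (sig m₁ m₂ * ((P x)ᴴ * (S x)⁻¹)))) *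
      res A z) = res Aᴴ w * (S x)⁻¹ - (S x)⁻¹ * res A z +
        (z - w) • (res Aᴴ w * (S x)⁻¹ * res A z) := by
    rw [← Matrix.smul_mul, ← Matrix.mul_smul, h1, Matrix.mul_sub, Matrix.sub_mul,
      ← Matrix.mul_assoc (res Aᴴ w) Aᴴ, h3, ← Matrix.mul_assoc (res Aᴴ w) (S x)⁻¹ A,
      Matrix.mul_assoc _ A, h2]
    simp only [Matrix.mul_add, Matrix.add_mul, Matrix.mul_one, Matrix.one_mul, Matrix.mul_smul,
      Matrix.smul_mul, Matrix.mul_assoc]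
    module
  have h5 := congrArg (fun M => sig m₁ m₂ * (P x)ᴴ * M * P x) h4
  simp only [Matrix.mul_add, Matrix.add_mul, Matrix.mul_sub, Matrix.sub_mul, Matrix.mul_smul,
    Matrix.smul_mul, Matrix.mul_assoc] at h5
  simp only [cotransfer, transfer, Matrix.add_mul, Matrix.mul_sub, Matrix.mul_one,
    Matrix.one_mul, Matrix.mul_smul, Matrix.smul_mul, Matrix.mul_assoc]
  rw [h5]
  module

theorem cotransfer_mul_transfer_self (hu : IsUnit (S x))
    (hnode : A * S x - S x * Aᴴ = Complex.I • (P x * sig m₁ m₂ * (P x)ᴴ)) {z : ℂ}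
    (hz : z ∉ spectrum ℂ A) (hz' : z ∉ spectrum ℂ Aᴴ) :
    cotransfer A P S z x * transfer A P S z x = 1 := by
  simp [cotransfer_mul_transfer hu hnode hz hz']

theorem transfer_sub_transfer {z w : ℂ} (hz : z ∉ spectrum ℂ A) (hw : w ∉ spectrum ℂ A) :
    transfer A P S w x - transfer A P S z x =
      ((z - w) * Complex.I) • (sig m₁ m₂ * (P x)ᴴ * (S x)⁻¹ * (res A z * res A w) * P x) := by
  have h : transfer A P S w x - transfer A P S z x =
      (-Complex.I) • (sig m₁ m₂ * (P x)ᴴ * (S x)⁻¹ * (res A w - res A z) * P x) := by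
    simp only [transfer, Matrix.mul_sub, Matrix.sub_mul]
    module
  rw [h, res_sub_res hz hw, Matrix.mul_smul, Matrix.smul_mul, smul_smul]
  congr 1
  ring

/-- The defining expression is the expansion of `(1 - X) q (1 + Y)`. -/
theorem nodeCoeff_eq (c : ℂ) (q : Matrix (Fin m₁ ⊕ Fin m₂) (Fin m₁ ⊕ Fin m₂) ℂ) :
    nodeCoeff A Aᴴ (S x) (P x) (Complex.I • (sig m₁ m₂ * (P x)ᴴ)) c q =
      transfer A P S c x * q * cotransfer A P S c x := by
  simp only [nodeCoeff, transfer, cotransfer, Matrix.smul_mul, Matrix.mul_smul, Matrix.sub_mul,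
    Matrix.mul_add, Matrix.one_mul, Matrix.mul_one, Matrix.mul_assoc]
  module

variable {c : Fin r → ℝ} {β : Fin r → ℝ → Matrix (Fin p) (Fin m₁ ⊕ Fin m₂) ℂ}

theorem betaT_eq (hS : (S x)ᴴ = S x) (k : Fin r) :
    betaT c β A P S k x = β k x * cotransfer A P S (c k) x := by
  have h := sig_mul_transfer_conjTranspose_mul_sig (m₁ := m₁) (m₂ := m₂) (A := A) (P := P) hS (c k)
  rw [RCLike.star_def, Complex.conj_ofReal] at h
  rw [betaT, ← h]
  simp only [Matrix.mul_assoc]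

theorem betaT_conjTranspose_mul_betaT (hS : (S x)ᴴ = S x) (k : Fin r) :
    (betaT c β A P S k x)ᴴ * betaT c β A P S k x = sig m₁ m₂ *
      (transfer A P S (c k) x * (sig m₁ m₂ * ((β k x)ᴴ * β k x)) * cotransfer A P S (c k) x) := by
  have h : (betaT c β A P S k x)ᴴ = sig m₁ m₂ * transfer A P S (c k) x * sig m₁ m₂ * (β k x)ᴴ := by
    simp only [betaT, Matrix.conjTranspose_mul, Matrix.conjTranspose_conjTranspose,
      sig_conjTranspose, Matrix.mul_assoc]
  rw [h, betaT_eq hS]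
  simp only [Matrix.mul_assoc]

theorem sig_mul_betaT_conjTranspose_mul_betaT (hS : (S x)ᴴ = S x) (k : Fin r) :
    sig m₁ m₂ * ((betaT c β A P S k x)ᴴ * betaT c β A P S k x) =
      transfer A P S (c k) x * (sig m₁ m₂ * ((β k x)ᴴ * β k x)) * cotransfer A P S (c k) x := by
  rw [betaT_conjTranspose_mul_betaT hS, ← Matrix.mul_assoc, sig_mul_sig, Matrix.one_mul]

theorem gbdtCoeff_eq (hS : (S x)ᴴ = S x) (k : Fin r) :
    gbdtCoeff c β A P S k x =
      (-Complex.I) • (sig m₁ m₂ * ((betaT c β A P S k x)ᴴ * betaT c β A P S k x)) := by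
  rw [sig_mul_betaT_conjTranspose_mul_betaT hS, gbdtCoeff, nodeCoeff_eq, Matrix.mul_smul,
    Matrix.smul_mul]

theorem gbdtSystem_eq (hS : (S x)ᴴ = S x) (z : ℂ) :
    gbdtSystem c β A P S z x = hamCoeff c (betaT c β A P S) z x := by
  simp only [gbdtSystem, hamCoeff, gbdtCoeff_eq hS, Finset.smul_sum, ← Finset.sum_neg_distrib]
  refine Finset.sum_congr rfl fun k _ => ?_
  module

/-- The left side is the contribution of one pole to the derivative of the transfer function. The
right side is regular at `z = c`, and dividing out `z - c` makes the two agree. -/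
theorem darboux_term {z : ℂ} {c : ℝ} (hzc : z ≠ c) (hz : z ∉ spectrum ℂ A)
    (hc : (c : ℂ) ∉ spectrum ℂ A) (hu : IsUnit (S x))
    (hnode : A * S x - S x * Aᴴ = Complex.I • (P x * sig m₁ m₂ * (P x)ᴴ))
    {H : Matrix (Fin m₁ ⊕ Fin m₂) (Fin m₁ ⊕ Fin m₂) ℂ} (hH : Hᴴ = H) :
    -(Complex.I • ((sig m₁ m₂ * ((-Complex.I) • (res A c * P x * sig m₁ m₂ * H))ᴴ * (S x)⁻¹ +
        sig m₁ m₂ * (P x)ᴴ * -((S x)⁻¹ *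
          -(res A c * P x * sig m₁ m₂ * H * sig m₁ m₂ * (P x)ᴴ * res Aᴴ c) * (S x)⁻¹)) *
        res A z * P x + sig m₁ m₂ * (P x)ᴴ * (S x)⁻¹ * res A z *
          ((-Complex.I) • (res A c * P x * sig m₁ m₂ * H)))) =
      (Complex.I * (z - c)⁻¹) • (transfer A P S c x * (sig m₁ m₂ * H) * cotransfer A P S c x *
        transfer A P S z x - transfer A P S z x * (sig m₁ m₂ * H)) := by
  have hc' : (c : ℂ) ∉ spectrum ℂ Aᴴ := by simpa using star_notMem_spectrum_conjTranspose hc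
  have hzc' : z - c ≠ 0 := sub_ne_zero.2 hzc
  -- With `q = j H`, the difference is `w_c q (cotransfer_c w_z - 1) + (w_c - w_z) q`; each summand
  -- carries the factor `z - c`.
  have h : transfer A P S c x * (sig m₁ m₂ * H) * cotransfer A P S c x * transfer A P S z x -
      transfer A P S z x * (sig m₁ m₂ * H) = ((z - c) * Complex.I) •
        (sig m₁ m₂ * (P x)ᴴ * (S x)⁻¹ * (res A z * res A c) * P x * (sig m₁ m₂ * H) -
          transfer A P S c x * (sig m₁ m₂ * H) *
            (sig m₁ m₂ * (P x)ᴴ * res Aᴴ c * (S x)⁻¹ * res A z * P x)) := by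
    rw [Matrix.mul_assoc _ (cotransfer A P S c x), cotransfer_mul_transfer hu hnode hz hc',
      Matrix.mul_sub, Matrix.mul_one, sub_right_comm, ← Matrix.sub_mul,
      transfer_sub_transfer hz hc, Matrix.smul_mul, Matrix.mul_smul, smul_sub]
  rw [h, smul_smul, show Complex.I * (z - c)⁻¹ * ((z - c) * Complex.I) = -1 by
    field_simp; exact Complex.I_sq]
  simp only [transfer, Matrix.conjTranspose_smul, Matrix.conjTranspose_mul, hH,
    sig_conjTranspose, res_conjTranspose, RCLike.star_def, Complex.conj_ofReal, map_neg,
    Complex.conj_I, neg_neg, Matrix.neg_mul, Matrix.sub_mul, Matrix.add_mul,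
    Matrix.one_mul, Matrix.mul_smul, Matrix.smul_mul, Matrix.mul_assoc, smul_add, smul_smul,
    mul_neg, Complex.I_mul_I]
  module

end Pointwise

/-! ### The Darboux equation and its consequences. -/

section Darboux

variable {r m₁ m₂ p n : ℕ} {I J : Set ℝ} {c : Fin r → ℝ}
  {β : Fin r → ℝ → Matrix (Fin p) (Fin m₁ ⊕ Fin m₂) ℂ}
  {A S₀ : Matrix (Fin n) (Fin n) ℂ} {P₀ : Matrix (Fin n) (Fin m₁ ⊕ Fin m₂) ℂ}
  {P : ℝ → Matrix (Fin n) (Fin m₁ ⊕ Fin m₂) ℂ} {S : ℝ → Matrix (Fin n) (Fin n) ℂ}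

theorem hasAEDerivOn_transfer {P' : ℝ → Matrix (Fin n) (Fin m₁ ⊕ Fin m₂) ℂ}
    {S' : ℝ → Matrix (Fin n) (Fin n) ℂ} (hJ : J.OrdConnected) (hP : HasAEDerivOn J P P')
    (hS : HasAEDerivOn J S S') (hu : ∀ x ∈ J, IsUnit (S x)) (z : ℂ) :
    HasAEDerivOn J (transfer A P S z) (fun x =>
      -(Complex.I • ((sig m₁ m₂ * (P' x)ᴴ * (S x)⁻¹ +
        sig m₁ m₂ * (P x)ᴴ * -((S x)⁻¹ * S' x * (S x)⁻¹)) * res A z * P x +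
        sig m₁ m₂ * (P x)ᴴ * (S x)⁻¹ * res A z * P' x))) := by
  have h := (((hP.conjTranspose.const_mul (sig m₁ m₂)).mul (hS.inv hJ hu)).mul_const
    (res A z)).mul hP
  simpa only [zero_sub] using! (HasAEDerivOn.const J 1).sub (h.const_smul Complex.I)

theorem IsNodeFlow.hasAEDerivOn_transfer (h : IsNodeFlow I c β A S₀ P₀ P S)
    (hJ : J.OrdConnected) (hJI : J ⊆ I) (hu : ∀ x ∈ J, IsUnit (S x)) (z : ℂ) :
    ∃ F, HasAEDerivOn J (transfer A P S z) F :=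
  ⟨_, GBDT.hasAEDerivOn_transfer hJ (h.P_eqn.mono hJI) (h.S_eqn.mono hJI) hu z⟩

theorem IsNodeFlow.solvesDarbouxEq_transfer (h : IsNodeFlow I c β A S₀ P₀ P S)
    (hI : I.OrdConnected) (h0 : (0 : ℝ) ∈ I) (hcA : ∀ k, (c k : ℂ) ∉ spectrum ℂ A)
    (hnode : A * S₀ - S₀ * Aᴴ = Complex.I • (P₀ * sig m₁ m₂ * P₀ᴴ)) (hS₀ : S₀ᴴ = S₀)
    (hJ : J.OrdConnected) (hJI : J ⊆ I) (hu : ∀ x ∈ J, IsUnit (S x)) {z : ℂ}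
    (hzc : ∀ k, z ≠ c k) (hz : z ∉ spectrum ℂ A) :
    SolvesDarbouxEq J (hamCoeff c β z) (hamCoeff c (betaT c β A P S) z) (transfer A P S z) := by
  refine (GBDT.hasAEDerivOn_transfer hJ (h.P_eqn.mono hJI) (h.S_eqn.mono hJI) hu z).congr_deriv
    fun x hx => ?_
  have hH : ∀ k, ((β k x)ᴴ * β k x)ᴴ = (β k x)ᴴ * β k x := fun k => by
    rw [Matrix.conjTranspose_mul, Matrix.conjTranspose_conjTranspose]
  have hterm := Finset.sum_congr rfl fun k (_ : k ∈ Finset.univ) =>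
    darboux_term (hzc k) hz (hcA k) (hu x hx) (h.node_identity hI h0 hcA hnode (hJI hx)) (hH k)
  simp only [hamCoeff, sig_mul_betaT_conjTranspose_mul_betaT (h.isHermitian hI h0 hS₀ (hJI hx)),
    Finset.smul_sum, Matrix.sum_mul, Matrix.mul_sum, ← Finset.sum_sub_distrib,
    ← Finset.sum_neg_distrib, ← Finset.sum_add_distrib, Matrix.conjTranspose_sum] at hterm ⊢
  refine Eq.trans ?_ (hterm.symm.trans ?_)
  · refine Finset.sum_congr rfl fun k _ => ?_
    simp only [Matrix.smul_mul, Matrix.mul_smul, smul_sub, smul_smul]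
  · refine Finset.sum_congr rfl fun k _ => ?_
    simp only [Matrix.mul_smul]

theorem SolvesDarbouxEq.isMatrixSolution_mul {ι : Type} [Fintype ι] {G G' W w : ℝ → Matrix ι ι ℂ}
    (hW : SolvesDarbouxEq J G G' W) (hw : IsMatrixSolution J G w) :
    IsMatrixSolution J G' (fun x => W x * w x) := by
  refine (HasAEDerivOn.mul hW hw).congr_deriv fun x _ => ?_
  rw [Matrix.sub_mul, Matrix.mul_assoc, Matrix.mul_assoc, sub_add_cancel]

theorem IsDarbouxMatrix.isFundamentalSolution_mul {ι : Type} [Fintype ι] [DecidableEq ι]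
    {G G' W w : ℝ → Matrix ι ι ℂ} (hW : IsDarbouxMatrix J G G' W)
    (hw : IsFundamentalSolution J G w) : IsFundamentalSolution J G' (fun x => W x * w x) :=
  ⟨hW.eqn.isMatrixSolution_mul hw.solution,
    fun x hx => (hW.nondegenerate x hx).mul (hw.invertible x hx)⟩

theorem IsNodeFlow.isUnit_transfer (h : IsNodeFlow I c β A S₀ P₀ P S)
    (hI : I.OrdConnected) (h0 : (0 : ℝ) ∈ I) (hcA : ∀ k, (c k : ℂ) ∉ spectrum ℂ A)
    (hnode : A * S₀ - S₀ * Aᴴ = Complex.I • (P₀ * sig m₁ m₂ * P₀ᴴ)) {x : ℝ} (hx : x ∈ I)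
    (hu : IsUnit (S x)) {z : ℂ} (hz : z ∉ spectrum ℂ A) (hz' : z ∉ spectrum ℂ Aᴴ) :
    IsUnit (transfer A P S z x) :=
  (Matrix.isUnit_iff_isUnit_det _).2 (Matrix.isUnit_det_of_left_inverse
    (cotransfer_mul_transfer_self hu (h.node_identity hI h0 hcA hnode hx) hz hz'))

/-- The transformed Hamiltonian is `(j w j) H (j wᴴ j)` with `w` the transfer function at `c k`,
which is continuous on `J`. -/
theorem IsNodeFlow.locSummableOn_betaT (h : IsNodeFlow I c β A S₀ P₀ P S)
    (hβ : ∀ k, LocSummableOn I (fun x => (β k x)ᴴ * β k x))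
    (hJ : J.OrdConnected) (hJI : J ⊆ I) (hu : ∀ x ∈ J, IsUnit (S x)) (k : Fin r) :
    LocSummableOn J (fun x => (betaT c β A P S k x)ᴴ * betaT c β A P S k x) := by
  obtain ⟨F, hF⟩ := h.hasAEDerivOn_transfer hJ hJI hu (c k)
  have hl := (hF.const_mul (sig m₁ m₂)).mul_const (sig m₁ m₂)
  have hr := (hF.conjTranspose.const_mul (sig m₁ m₂)).mul_const (sig m₁ m₂)
  have hsum := (((hβ k).mono hJI).continuousOn_mul hJ hl.continuousOn).mul_continuousOn hJ
    hr.continuousOn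
  simpa only [betaT, Matrix.conjTranspose_mul, Matrix.conjTranspose_conjTranspose,
    sig_conjTranspose, Matrix.mul_assoc] using hsum

end Darboux

end GBDT
end
theorem theorem3p1 {r m₁ m₂ p n : ℕ}
    -- the interval on which the systems are considered
    (I : Set ℝ) (hI : I.OrdConnected) (h_zero : (0 : ℝ) ∈ I)
    -- the initial generalised Hamiltonian system
    (c : Fin r → ℝ) (hc : Function.Injective c)
    (β : Fin r → ℝ → Matrix (Fin p) (Fin m₁ ⊕ Fin m₂) ℂ)
    (hβ : ∀ k, GBDT.LocSummableOn I (fun x => (β k x)ᴴ * β k x))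
    -- the triple of matrices
    (A S₀ : Matrix (Fin n) (Fin n) ℂ) (P₀ : Matrix (Fin n) (Fin m₁ ⊕ Fin m₂) ℂ)
    (hcA : ∀ k, (c k : ℂ) ∉ spectrum ℂ A)
    (hnode : A * S₀ - S₀ * Aᴴ = Complex.I • (P₀ * GBDT.sig m₁ m₂ * P₀ᴴ))
    (hS₀ : S₀ᴴ = S₀) :
    -- the matrix functions determined by the triple exist and are unique
    (∃ P S, GBDT.IsNodeFlow I c β A S₀ P₀ P S ∧
      ∀ P' S', GBDT.IsNodeFlow I c β A S₀ P₀ P' S' → Set.EqOn P' P I ∧ Set.EqOn S' S I) ∧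
    ∀ P S, GBDT.IsNodeFlow I c β A S₀ P₀ P S →
      -- on every subinterval on which `S` is invertible
      ∀ J : Set ℝ, J.OrdConnected → J ⊆ I → (∀ x ∈ J, IsUnit (S x)) →
        -- the transformed Hamiltonians are locally summable
        (∀ k, GBDT.LocSummableOn J
          (fun x => (GBDT.betaT c β A P S k x)ᴴ * GBDT.betaT c β A P S k x)) ∧
        -- the transformed system is the generalised Hamiltonian system of `β̃ₖ`
        (∀ k, ∀ x ∈ J, GBDT.gbdtCoeff c β A P S k x =
          (-Complex.I) • (GBDT.sig m₁ m₂ *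
            ((GBDT.betaT c β A P S k x)ᴴ * GBDT.betaT c β A P S k x))) ∧
        (∀ z : ℂ, (∀ k, z ≠ c k) → ∀ x ∈ J, GBDT.gbdtSystem c β A P S z x =
          GBDT.hamCoeff c (GBDT.betaT c β A P S) z x) ∧
        -- the transfer function satisfies the Darboux equation and maps solutions to solutions
        (∀ z : ℂ, (∀ k, z ≠ c k) → z ∉ spectrum ℂ A →
          GBDT.SolvesDarbouxEq J (GBDT.hamCoeff c β z)
            (GBDT.hamCoeff c (GBDT.betaT c β A P S) z) (GBDT.transfer A P S z) ∧
          ∀ w, GBDT.IsMatrixSolution J (GBDT.hamCoeff c β z) w →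
            GBDT.IsMatrixSolution J (GBDT.hamCoeff c (GBDT.betaT c β A P S) z)
              (fun x => GBDT.transfer A P S z x * w x)) ∧
        -- it is a Darboux matrix and maps fundamental solutions to fundamental solutions
        (∀ z : ℂ, (∀ k, z ≠ c k) → z ∉ spectrum ℂ A → z ∉ spectrum ℂ Aᴴ →
          GBDT.IsDarbouxMatrix J (GBDT.hamCoeff c β z)
            (GBDT.hamCoeff c (GBDT.betaT c β A P S) z) (GBDT.transfer A P S z) ∧
          ∀ w, GBDT.IsFundamentalSolution J (GBDT.hamCoeff c β z) w →
            GBDT.IsFundamentalSolution J (GBDT.hamCoeff c (GBDT.betaT c β A P S) z)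
              (fun x => GBDT.transfer A P S z x * w x)) := by
  refine ⟨?_, fun P S h J hJ hJI hu => ⟨h.locSummableOn_betaT hβ hJ hJI hu,
    fun k x hx => GBDT.gbdtCoeff_eq (h.isHermitian hI h_zero hS₀ (hJI hx)) k,
    fun z _ x hx => GBDT.gbdtSystem_eq (h.isHermitian hI h_zero hS₀ (hJI hx)) z,
    fun z hzc hz => ?_, fun z hzc hz hz' => ?_⟩⟩
  · obtain ⟨P, S, h⟩ := GBDT.exists_isNodeFlow (c := c) (A := A) (S₀ := S₀) (P₀ := P₀) hI h_zero hβ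
    exact ⟨P, S, h, fun P' S' h' => h'.unique hI h_zero hβ h⟩
  · have hD := h.solvesDarbouxEq_transfer hI h_zero hcA hnode hS₀ hJ hJI hu hzc hz
    exact ⟨hD, fun w hw => hD.isMatrixSolution_mul hw⟩
  · have hD : GBDT.IsDarbouxMatrix J (GBDT.hamCoeff c β z)
        (GBDT.hamCoeff c (GBDT.betaT c β A P S) z) (GBDT.transfer A P S z) :=
      ⟨h.solvesDarbouxEq_transfer hI h_zero hcA hnode hS₀ hJ hJI hu hzc hz,
        fun x hx => h.isUnit_transfer hI h_zero hcA hnode (hJI hx) (hu x hx) hz hz'⟩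
    exact ⟨hD, fun w hw => hD.isFundamentalSolution_mul hw⟩
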